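/- Identify the plane with $\mathbb{R}^2$ and let $G_3$ be the group of all plane motions $p\mapsto R p+v$, where $v\in\mathbb{R}^2$ and $R$ is a rotation by a multiple of $2\pi/3$. A set $K$ is a $G_3$-covering of a family $S$ of planar sets if for every $T\in S$ there is $g\in G_3$ with $gT\subseteq K$. Let $\Gamma_3=\{(x,y): y^2\le 1+2x,\ y^2\le 1-2x,\ 0\le y\le 2/3\}$. Its left side lies on the curve $y=\sqrt{1+2x}$ and its bottom side on the $x$-axis. For $t\in[-4/9,-1/3]$ let $X(t)=(t,\sqrt{1+2t})$ on the left side, let $Y(t)=\bigl(t+\sqrt{4/9-(1+2t)},\,0\bigr)$ on the bottom side, and let $Z(t)$ be the point such that $X(t)Y(t)Z(t)$ is an equilateral triangle (of side $2/3$, hence perimeter $2$) with vertices in counterclockwise order; that is, $$Z(t)=\left(\frac{\sqrt{6t+3}+\sqrt{-2t-\frac59}+2t}{2},\ \frac{\sqrt{-6t-\frac53}+\sqrt{2t+1}}{2}\right).$$ (As $t$ grows from $-4/9$, where $Y(t)Z(t)$ is vertical and $Z(t)$ lies on the line $y=2/3$, to $-1/3$, where $Z(t)$ lies on $y=\sqrt{1-2x}$,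 the triangle rolls clockwise inside $\Gamma_3$.) Let $\Gamma_{\mathrm t}$ be obtained from $\Gamma_3$ by removing all points lying strictly above the curve $\{Z(t): -4/9\le t\le -1/3\}$ (points $(x,y)$ such that for some $t\in[-4/9,-1/3]$ the point $Z(t)$ has first coordinate $x$ and second coordinate less than $y$), and all points lying strictly above the mirror image of this curve in the $y$-axis. **Theorem.** The set $\Gamma_{\mathrm t}$ is convex, its area is less than $0.5634$, and it is a $G_3$-covering of all triangles of perimeter $2$ (degenerate triangles included). -/

import Mathlib

open MeasureTheory

namespace TriangleCover

/-! The Euclidean plane is identified with the complex plane, so a rotation about the origin is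
multiplication by a unit complex number, and `volume` on `ℂ` is the area. -/

/-- The group of plane motions composed of a rotation by a multiple of `2 * π / k` and a
translation. -/
noncomputable def rotTransGroup (k : ℕ) : Subgroup (Equiv.Perm ℂ) where
  carrier := {g | ∃ i : ℤ, ∃ v : ℂ, ∀ z : ℂ,
    g z = Complex.exp (2 * (i : ℂ) * (Real.pi : ℂ) * Complex.I / (k : ℂ)) * z + v}
  one_mem' := ⟨0, 0, fun z => by simp⟩
  mul_mem' := by
    rintro g h ⟨i, v, hg⟩ ⟨j, w, hh⟩
    refine ⟨i + j, Complex.exp (2 * (i : ℂ) * (Real.pi : ℂ) * Complex.I / (k : ℂ)) * w + v,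
      fun z => ?_⟩
    rw [Equiv.Perm.mul_apply, hg, hh, mul_add, ← mul_assoc, ← Complex.exp_add, add_assoc]
    push_cast
    ring_nf
  inv_mem' := by
    rintro g ⟨i, v, hg⟩
    refine ⟨-i, -(Complex.exp (-(2 * (i : ℂ) * (Real.pi : ℂ) * Complex.I / (k : ℂ))) * v),
      fun z => ?_⟩
    rw [Equiv.Perm.inv_eq_iff_eq, hg]
    have h : Complex.exp (2 * ((-i : ℤ) : ℂ) * (Real.pi : ℂ) * Complex.I / (k : ℂ))
        = Complex.exp (-(2 * (i : ℂ) * (Real.pi : ℂ) * Complex.I / (k : ℂ))) := by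
      congr 1
      push_cast
      ring
    rw [h, mul_add, ← mul_assoc, mul_neg, ← mul_assoc, ← Complex.exp_add]
    simp

/-- `K` is a `G`-covering of the family `S` of planar objects. -/
def IsCovering (G : Subgroup (Equiv.Perm ℂ)) (S : Set (Set ℂ)) (K : Set ℂ) : Prop :=
  ∀ T ∈ S, ∃ g ∈ G, g '' T ⊆ K

/-- All (closed, filled) triangles of perimeter `p`; degenerate triangles are included. -/
def trianglesOfPerimeter (p : ℝ) : Set (Set ℂ) :=
  {T | ∃ X Y Z : ℂ, dist X Y + dist Y Z + dist Z X = p ∧ T = convexHull ℝ {X, Y, Z}}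

/-- The convex region bounded by the parabolas `y ^ 2 = 1 + 2 * x` and `y ^ 2 = 1 - 2 * x` and
containing the origin. -/
def parabolaRegion : Set ℂ :=
  {z | z.im ^ 2 ≤ 1 + 2 * z.re ∧ z.im ^ 2 ≤ 1 - 2 * z.re}

/-- The part of the parabola region between the lines `y = 0` and `y = 2 / 3`. -/
def gammaThree : Set ℂ :=
  {z | z ∈ parabolaRegion ∧ 0 ≤ z.im ∧ z.im ≤ 2 / 3}

/-- The vertex of the rolling triangle that runs along the left side of `gammaThree`; the
parameter `t` is its abscissa. -/
noncomputable def rollX (t : ℝ) : ℂ := ⟨t, √(1 + 2 * t)⟩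

/-- The vertex of the rolling triangle that runs along the bottom side of `gammaThree`: the point
of the real axis at distance `2 / 3` from `rollX t` and to the right of it. -/
noncomputable def rollY (t : ℝ) : ℂ := ⟨t + √((2 / 3) ^ 2 - (1 + 2 * t)), 0⟩

/-- The third vertex of the rolling equilateral triangle, which has `rollX t`, `rollY t`, `rollZ t`
in counterclockwise order. -/
noncomputable def rollZ (t : ℝ) : ℂ :=
  rollX t + Complex.exp ((Real.pi / 3 : ℝ) * Complex.I) * (rollY t - rollX t)

/-- The points strictly above the trajectory of the third vertex of the rolling triangle. The
triangle starts with a vertical side at `t = -4 / 9`, where this vertex is on the top side of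
`gammaThree`, and turns clockwise until `t = -1 / 3`, where it reaches the right side. -/
noncomputable def aboveTrajectory : Set ℂ :=
  {z | ∃ t ∈ Set.Icc (-4 / 9 : ℝ) (-1 / 3), z.re = (rollZ t).re ∧ (rollZ t).im < z.im}

/-- The shaved region: the points of `gammaThree` that are neither above the trajectory nor above
its mirror image in the vertical axis. -/
noncomputable def gammaT : Set ℂ :=
  gammaThree \ (aboveTrajectory ∪ {z | (⟨-z.re, z.im⟩ : ℂ) ∈ aboveTrajectory})

/-- The coordinates of the third vertex in closed form. -/
theorem rollZ_eq (t : ℝ) :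
    rollZ t = ⟨(√(6 * t + 3) + √(-2 * t - 5 / 9) + 2 * t) / 2,
      (√(-6 * t - 5 / 3) + √(2 * t + 1)) / 2⟩ := by
  have h1 : √(6 * t + 3) = √3 * √(1 + 2 * t) := by
    rw [← Real.sqrt_mul (by norm_num)]
    congr 1
    ring
  have h2 : √(-6 * t - 5 / 3) = √3 * √((2 / 3) ^ 2 - (1 + 2 * t)) := by
    rw [← Real.sqrt_mul (by norm_num)]
    congr 1
    ring
  have h3 : √(-2 * t - 5 / 9) = √((2 / 3) ^ 2 - (1 + 2 * t)) := by
    congr 1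
    ring
  have h4 : √(2 * t + 1) = √(1 + 2 * t) := by rw [add_comm]
  have he : Complex.exp ((Real.pi / 3 : ℝ) * Complex.I) = ⟨1 / 2, √3 / 2⟩ := by
    apply Complex.ext
    · rw [Complex.exp_ofReal_mul_I_re, Real.cos_pi_div_three]
    · rw [Complex.exp_ofReal_mul_I_im, Real.sin_pi_div_three]
  rw [h1, h2, h3, h4, rollZ, he]
  apply Complex.ext
  · simp [rollX, rollY]
    ring
  · simp [rollX, rollY]
    ring

end TriangleCover

namespace TriangleCover

/-! ### Metric inequalities in coordinates -/

/-! In horizontal slices `gammaT` is `|x| ≤ halfWidth y`, `0 ≤ y ≤ 2 / 3`, because the trajectory of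
`rollZ` is a strictly decreasing graph over the height (`gammaT_eq`). The parabola piece and the
trajectory piece of `halfWidth` meet at height `√3 / 3` with common slope `-√3 / 3`, so `halfWidth`
is concave and the region convex. Its area is an explicit integral.

For the covering, the widths of a triangle in three directions at angles of 60° add up to at most
its perimeter. Turning the smallest one vertical makes the height at most `2 / 3` and not larger
than either oblique width (`exists_isLow`). With the lowest vertex on the real axis, the admissible
horizontal shifts of each vertex form an interval. A common shift exists once these intervals meet
pairwise, that is, once the horizontal distance of any two vertices is at most the sum of the
half-widths at their heights (`extents_le`).

The hard pair is the middle and the top vertex, at heights `s ≤ h` and horizontal distance `D`.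
Reflection gives `D ^ 2 ≤ (1 - s ^ 2) * (1 - h ^ 2)` (`ellipse_bound`), and AM-GM then settles `h ≤
√3 / 3`. For larger `h` the benchmark is the equilateral triangle of side `2 / 3` and height `h`,
whose middle vertex has height `σ = leftHeight h`. The width conditions force `s ≤ σ` or a
contradiction. For `s` near `σ` the perimeter is linearised at the equilateral triangle
(`tangent_decides`). For smaller `s` either the slack in AM-GM exceeds the shaved amount
(`ellipse_decides`) or the perimeter exceeds 2 (`not_perim_of_low`). -/

theorem linear_le_mul_sqrt {α β M : ℝ} (hM : 0 ≤ M) (h : α ^ 2 + β ^ 2 ≤ M ^ 2) (x y : ℝ) :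
    α * x + β * y ≤ M * √(x ^ 2 + y ^ 2) := by
  refine le_of_abs_le (abs_le_of_sq_le_sq ?_ (by positivity))
  rw [mul_pow, Real.sq_sqrt (by positivity)]
  nlinarith [sq_nonneg (α * y - β * x),
    mul_nonneg (sub_nonneg.2 h) (add_nonneg (sq_nonneg x) (sq_nonneg y))]

theorem linear_le_sqrt {α β : ℝ} (h : α ^ 2 + β ^ 2 ≤ 1) (x y : ℝ) :
    α * x + β * y ≤ √(x ^ 2 + y ^ 2) := by
  simpa using linear_le_mul_sqrt zero_le_one (by simpa using h) x y

theorem abs_left_le_sqrt (x y : ℝ) : |x| ≤ √(x ^ 2 + y ^ 2) :=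
  Real.abs_le_sqrt (by nlinarith [sq_nonneg y])

theorem abs_right_le_sqrt (x y : ℝ) : |y| ≤ √(x ^ 2 + y ^ 2) :=
  Real.abs_le_sqrt (by nlinarith [sq_nonneg x])

theorem sqrt_add_le (a b c d : ℝ) :
    √((a + c) ^ 2 + (b + d) ^ 2) ≤ √(a ^ 2 + b ^ 2) + √(c ^ 2 + d ^ 2) := by
  have h := norm_add_le (⟨a, b⟩ : ℂ) ⟨c, d⟩
  simpa [Complex.norm_eq_sqrt_sq_add_sq] using h

/-- The perimeter of the triangle with vertices `(0, s)`, `(D, h)`, `(y, 0)`. -/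
noncomputable def perim (s h D y : ℝ) : ℝ :=
  √(D ^ 2 + (h - s) ^ 2) + √((D - y) ^ 2 + h ^ 2) + √(y ^ 2 + s ^ 2)

/-- Reflecting the bottom vertex path in the axis, the two sides through that vertex have total
length at least `B`, while the third side is `A`. Now `A + B ≤ 2` and `B ^ 2 - A ^ 2 = 4 * h * s`
give `B ≤ 1 + h * s`. -/
theorem ellipse_bound {s h D y : ℝ} (hP : perim s h D y ≤ 2) :
    D ^ 2 ≤ (1 - s ^ 2) * (1 - h ^ 2) := by
  have h1 := sqrt_add_le y s (D - y) h
  rw [show y + (D - y) = D by ring] at h1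
  unfold perim at hP
  set A := √(D ^ 2 + (h - s) ^ 2)
  set B := √(D ^ 2 + (s + h) ^ 2)
  have hA : A ^ 2 = D ^ 2 + (h - s) ^ 2 := Real.sq_sqrt (by positivity)
  have hB : B ^ 2 = D ^ 2 + (s + h) ^ 2 := Real.sq_sqrt (by positivity)
  have hA0 : 0 ≤ A := Real.sqrt_nonneg _
  have hB0 : 0 ≤ B := Real.sqrt_nonneg _
  have h2 : A ≤ 2 - B := by linarith
  have h3 : B ≤ 1 + h * s := by nlinarith
  nlinarith

theorem sqrt_three_bounds : (1.732 : ℝ) < √3 ∧ √3 < 1.7321 := by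
  constructor
  · rw [Real.lt_sqrt (by norm_num)]; norm_num
  · rw [Real.sqrt_lt' (by norm_num)]; norm_num

theorem sqrt_three_sq : √3 ^ 2 = (3 : ℝ) := Real.sq_sqrt (by norm_num)

/-- If two of the three widths are at least the height, the equilateral triangle with the same
vertical coordinates has side at most `2 / 3`. -/
theorem equilateral_side_le {s h D y : ℝ} (hs : 0 ≤ s) (hsh : s ≤ h) (hh : 0 < h)
    (hD : h + s ≤ √3 * D) (hy : 2 * h - s ≤ √3 * y) (hP : perim s h D y ≤ 2) :
    h ^ 2 - h * s + s ^ 2 ≤ 1 / 3 := by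
  have hr := sqrt_three_sq
  have hr0 := sqrt_three_bounds.1
  set r := √3
  set L := √((4 / 3) * (h ^ 2 - h * s + s ^ 2)) with hL
  have hpos : 0 < h ^ 2 - h * s + s ^ 2 := by nlinarith [sq_nonneg (h - s)]
  have hL0 : 0 < L := Real.sqrt_pos.2 (by linarith)
  have hLL : L ^ 2 = (4 / 3) * (h ^ 2 - h * s + s ^ 2) := Real.sq_sqrt (by linarith)
  -- Each side is projected onto the corresponding side vector of the equilateral triangle with
  -- vertex heights `s`, `h`, `0`, whose side is `L`. The sum gives `3 * L ^ 2 ≤ 2 * L`.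
  have e1 := linear_le_mul_sqrt (α := (h + s) * r / 3) (β := h - s) hL0.le (by nlinarith) D (h - s)
  have e2 := linear_le_mul_sqrt (α := (2 * s - h) * r / 3) (β := h) hL0.le (by nlinarith) (D - y) h
  have e3 := linear_le_mul_sqrt (α := (2 * h - s) * r / 3) (β := s) hL0.le (by nlinarith) y s
  have e4 := mul_le_mul_of_nonneg_left hP hL0.le
  unfold perim at e4
  have e5 : 3 * L ^ 2 ≤ 2 * L := by
    have := mul_le_mul_of_nonneg_left hD hs
    have := mul_le_mul_of_nonneg_left hy (sub_nonneg.2 hsh)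
    nlinarith
  have e6 : L ≤ 2 / 3 := by nlinarith
  nlinarith

/-! ### The half-width of the shaved region at a given height -/

/-- The larger root `σ` of `y ^ 2 - y * σ + σ ^ 2 = 1 / 3`: the height of the left vertex of the
rolling triangle when the third vertex is at height `y`. -/
noncomputable def leftHeight (y : ℝ) : ℝ := (y + √(4 / 3 - 3 * y ^ 2)) / 2

/-- The abscissa of the third vertex of the rolling triangle when it is at height `y`. -/
noncomputable def rollWidth (y : ℝ) : ℝ :=
  -1 / 2 + (y + leftHeight y) * √3 / 3 + leftHeight y ^ 2 / 2

/-- The abscissa of the right boundary of the shaved region at height `y`. -/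
noncomputable def halfWidth (y : ℝ) : ℝ :=
  if y ≤ √3 / 3 then (1 - y ^ 2) / 2 else rollWidth y

theorem leftHeight_spec {y : ℝ} (h2 : y ≤ 2 / 3) (h0 : 0 ≤ y) :
    y ^ 2 - y * leftHeight y + leftHeight y ^ 2 = 1 / 3 := by
  have := Real.sq_sqrt (show 0 ≤ 4 / 3 - 3 * y ^ 2 by nlinarith)
  unfold leftHeight
  nlinarith

theorem half_le_leftHeight (y : ℝ) : y / 2 ≤ leftHeight y := by
  have := Real.sqrt_nonneg (4 / 3 - 3 * y ^ 2)
  unfold leftHeight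
  linarith

theorem leftHeight_le_self {y : ℝ} (h : √3 / 3 ≤ y) : leftHeight y ≤ y := by
  have hr := sqrt_three_sq
  have hr0 := sqrt_three_bounds.1
  have : √(4 / 3 - 3 * y ^ 2) ≤ y := Real.sqrt_le_iff.2 ⟨by linarith, by nlinarith⟩
  unfold leftHeight
  linarith

theorem le_leftHeight {s y : ℝ} (h : y ^ 2 - y * s + s ^ 2 ≤ 1 / 3) : s ≤ leftHeight y := by
  have : 2 * s - y ≤ √(4 / 3 - 3 * y ^ 2) := Real.le_sqrt_of_sq_le (by nlinarith)
  unfold leftHeight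
  linarith

theorem leftHeight_le {y : ℝ} (h1 : √3 / 3 ≤ y) (h2 : y ≤ 2 / 3) : leftHeight y ≤ √3 / 3 := by
  have hr := sqrt_three_sq
  have hr0 := sqrt_three_bounds.1
  have h3 := leftHeight_le_self h1
  have h4 := half_le_leftHeight y
  have h5 := leftHeight_spec h2 (by linarith)
  have : leftHeight y ^ 2 ≤ 1 / 3 := by nlinarith
  nlinarith

theorem one_third_le_leftHeight {y : ℝ} (h2 : y ≤ 2 / 3) (h0 : 0 ≤ y) :
    1 / 3 ≤ leftHeight y := by
  apply le_leftHeight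
  nlinarith

/-- The extent to which the rolling triangle cuts into the parabola region. -/
theorem rollWidth_eq_sub {y : ℝ} (h2 : y ≤ 2 / 3) (h0 : 0 ≤ y) :
    rollWidth y = (1 - y ^ 2) / 2 -
      2 / 9 * (1 - √3 * (y + leftHeight y) / 2) * (√3 * (y + leftHeight y) / 2 + 4) := by
  have h := leftHeight_spec h2 h0
  have hr := sqrt_three_sq
  unfold rollWidth
  linear_combination (1 / 3 : ℝ) * h - (y + leftHeight y) ^ 2 / 18 * hr

theorem sum_leftHeight_le {y : ℝ} (h2 : y ≤ 2 / 3) (h0 : 0 ≤ y) :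
    √3 * (y + leftHeight y) / 2 ≤ 1 := by
  have h := leftHeight_spec h2 h0
  have hr := sqrt_three_sq
  have : (√3 * (y + leftHeight y)) ^ 2 ≤ 2 ^ 2 := by
    rw [mul_pow, hr]; nlinarith [sq_nonneg (y - leftHeight y)]
  have := abs_le_of_sq_le_sq this (by norm_num)
  linarith [(abs_le.1 this).2]

theorem rollWidth_le {y : ℝ} (h2 : y ≤ 2 / 3) (h0 : 0 ≤ y) : rollWidth y ≤ (1 - y ^ 2) / 2 := by
  rw [rollWidth_eq_sub h2 h0]
  have h1 := sum_leftHeight_le h2 h0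
  have h3 : 0 ≤ √3 * (y + leftHeight y) := by
    have := half_le_leftHeight y
    have := sqrt_three_bounds.1
    exact mul_nonneg (by linarith) (by linarith)
  have : 0 ≤ (1 - √3 * (y + leftHeight y) / 2) * (√3 * (y + leftHeight y) / 2 + 4) :=
    mul_nonneg (by linarith) (by linarith)
  linarith

/-! ### The horizontal extent of a triangle in its lowest position -/

/-- Far from the equilateral triangles the ellipse bound decides. -/
theorem ellipse_decides {s h D C S : ℝ} (hC : 0 ≤ C) (hCS : C ^ 2 + S ^ 2 = 1) (hS : 0 ≤ S)
    (hS1 : S ≤ 0.15) (hh : h = C * √3 / 3 + S / 3) (hs0 : 0 ≤ s)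
    (hs : s ≤ √3 / 3 - 7 / 3 * S - S ^ 2) (hD : D ^ 2 ≤ (1 - s ^ 2) * (1 - h ^ 2)) :
    D ≤ (1 - s ^ 2) / 2 + ((1 - h ^ 2) / 2 - 2 / 9 * (1 - C) * (C + 4)) := by
  obtain ⟨hr1, hr2⟩ := sqrt_three_bounds
  have hr := sqrt_three_sq
  set r := √3
  have hC1 : 0.988 ≤ C := by nlinarith
  have hC2 : C ≤ 1 := by nlinarith
  have hC3 : 1 - C ≤ 0.504 * S ^ 2 := by nlinarith
  have hC4 : 0 ≤ 1 - C := by linarith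
  have hCr : (1 - C) * r ≤ 0.504 * S ^ 2 * 1.7321 := mul_le_mul hC3 hr2.le (by linarith) (by positivity)
  have hS2 : S ^ 2 ≤ 0.15 * S := by nlinarith
  have hsum : 0.82 ≤ h + (r / 3 - 7 / 3 * S - S ^ 2) := by
    linarith
  -- The threshold on `s` makes `h - s` at least about `8 / 3 * S`, and `8 / 3 * 0.82 > 2`.
  have hsh : 2 * S ≤ h ^ 2 - s ^ 2 := by
    have hd : (8 / 3) * S ≤ h - (r / 3 - 7 / 3 * S - S ^ 2) := by linarith [sq_nonneg S]
    have : (8 / 3) * S * 0.82 ≤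
        (h - (r / 3 - 7 / 3 * S - S ^ 2)) * (h + (r / 3 - 7 / 3 * S - S ^ 2)) :=
      mul_le_mul hd hsum (by norm_num) (by linarith)
    have : s ^ 2 ≤ (r / 3 - 7 / 3 * S - S ^ 2) ^ 2 := pow_le_pow_left₀ hs0 hs 2
    linarith
  have hh1 : 1 / 3 ≤ h ^ 2 := by
    have : r / 3 ≤ h := by linarith
    nlinarith
  set Δ := 2 / 9 * (1 - C) * (C + 4) with hΔ
  have hΔ0 : 0 ≤ Δ := by positivity
  have hΔ1 : Δ ≤ 0.5601 * S ^ 2 := by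
    have := mul_le_mul hC3 (show C + 4 ≤ 5 by linarith) (by linarith) (by positivity)
    linarith
  have hΔ2 : Δ ≤ 0.1 := by linarith
  -- This says that the AM-GM slack of the two parabola half-widths pays for the shaved amount `Δ`;
  -- both sides are of order `S ^ 2`.
  have key : 4 * Δ * (2 - h ^ 2 - s ^ 2) ≤ (h ^ 2 - s ^ 2) ^ 2 := by
    have : 4 * Δ * (2 - h ^ 2 - s ^ 2) ≤ 4 * Δ * (5 / 3) :=
      mul_le_mul_of_nonneg_left (by linarith [sq_nonneg s]) (by positivity)
    have : (2 * S) ^ 2 ≤ (h ^ 2 - s ^ 2) ^ 2 := pow_le_pow_left₀ (by positivity) hsh 2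
    linarith
  refine le_of_abs_le (abs_le_of_sq_le_sq ?_ ?_)
  · linarith [sq_nonneg Δ]
  · have h1 : s ^ 2 ≤ 0.6 ^ 2 := pow_le_pow_left₀ hs0 (by linarith [sq_nonneg S]) 2
    have h2 : C * r ≤ 1 * 1.7321 := mul_le_mul hC2 hr2.le (by linarith) (by norm_num)
    have h3 : h ^ 2 ≤ 0.65 ^ 2 := pow_le_pow_left₀ (by rw [hh]; positivity) (by linarith) 2
    linarith

/-- `hD` bounds `D - 2 / 3 * C` linearly in `σ - s`, where `σ = C * √3 / 3 - S / 3`. The allowance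
`(σ ^ 2 - s ^ 2) / 2` has slope `(σ + s) / 2`, which is steep enough as long as `s` is above the
threshold. -/
theorem tangent_decides {s D C S : ℝ} (hC : 0 < C) (hCS : C ^ 2 + S ^ 2 = 1) (hS : 0 ≤ S)
    (hS1 : S ≤ 1 / 2) (hσ : s ≤ C * √3 / 3 - S / 3)
    (hs : √3 / 3 - 7 / 3 * S - S ^ 2 ≤ s)
    (hD : (C - S * √3 / 3) * (D - 2 / 3 * C) ≤
      (C * √3 / 3 - S / 3 - s) * (C * √3 / 3 - 5 / 3 * S)) :
    D ≤ 2 / 3 * C + ((C * √3 / 3 - S / 3) ^ 2 - s ^ 2) / 2 := by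
  obtain ⟨hr1, hr2⟩ := sqrt_three_bounds
  have hr := sqrt_three_sq
  set r := √3
  -- In terms of `k = S / √3` the coefficient of `D` is `C - k`, and the comparison of slopes
  -- becomes nearly polynomial in `C` and `k`.
  obtain ⟨k, hk⟩ : ∃ k, S = r * k := ⟨S / r, by field_simp⟩
  have hk0 : 0 ≤ k := by
    by_contra hneg
    nlinarith
  have hk1 : k ≤ 0.29 := by nlinarith
  have hSr : S * r / 3 = k := by rw [hk]; linear_combination (k / 3) * hr
  have hCk : C ^ 2 + 3 * k ^ 2 = 1 := by rw [hk] at hCS; linear_combination hCS - k ^ 2 * hr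
  have hC1 : C ≤ 1 := by nlinarith
  have hC2 : 0.86 ≤ C := by nlinarith
  have hC3 : C * (1 - C) ≤ 1.5 * k ^ 2 := by nlinarith
  rw [hSr] at hD
  have key : 2 * (C - 5 * k) ≤ (C - k) * (C + 1 - 8 * k - 3 * r * k ^ 2) := by
    have h1 : 0 ≤ k * (1 - C) := mul_nonneg hk0 (by linarith)
    have h2 : 0 ≤ r * k ^ 3 := by positivity
    have h3 : r * C * k ^ 2 ≤ 1.7321 * k ^ 2 :=
      mul_le_mul_of_nonneg_right (by nlinarith) (by positivity)
    nlinarith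
  have hslope : 2 * (C * r / 3 - 5 / 3 * S) ≤ (C - k) * (C * r / 3 - S / 3 + s) := by
    have h1 : (C - k) * (C * r / 3 - S / 3 + (r / 3 - 7 / 3 * S - S ^ 2)) ≤
        (C - k) * (C * r / 3 - S / 3 + s) :=
      mul_le_mul_of_nonneg_left (by linarith) (by linarith)
    refine le_trans ?_ h1
    have h2 := mul_le_mul_of_nonneg_left key (show 0 ≤ r / 3 by linarith)
    have h3 : r / 3 * (C + 1 - 8 * k - 3 * r * k ^ 2) =
        C * r / 3 - S / 3 + (r / 3 - 7 / 3 * S - S ^ 2) := by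
      rw [hk]; ring
    have h4 : r / 3 * (2 * (C - 5 * k)) = 2 * (C * r / 3 - 5 / 3 * S) := by rw [hk]; ring
    rw [← h3, ← h4]
    linarith
  have h5 := mul_le_mul_of_nonneg_left hslope (sub_nonneg.2 hσ)
  have h6 : (C - k) * (D - 2 / 3 * C) ≤
      (C - k) * (((C * r / 3 - S / 3) ^ 2 - s ^ 2) / 2) := by nlinarith
  have := le_of_mul_le_mul_left h6 (by linarith)
  linarith

theorem halfWidth_of_le {y : ℝ} (h : y ≤ √3 / 3) : halfWidth y = (1 - y ^ 2) / 2 := if_pos h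

theorem halfWidth_of_ge {y : ℝ} (h : √3 / 3 < y) : halfWidth y = rollWidth y := if_neg h.not_ge

/-- The constant lies just below the least value `rollWidth (2 / 3) = √3 / 3 - 4 / 9`. -/
theorem rollWidth_ge {y : ℝ} (h1 : √3 / 3 ≤ y) (h2 : y ≤ 2 / 3) : 0.132 ≤ rollWidth y := by
  obtain ⟨hr1, hr2⟩ := sqrt_three_bounds
  have hr := sqrt_three_sq
  have h3 := leftHeight_spec h2 (by linarith)
  have h4 := one_third_le_leftHeight h2 (by linarith)
  have h5 := leftHeight_le_self h1
  unfold rollWidth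
  set σ := leftHeight y
  have h6 : 1 ≤ y + σ := by nlinarith
  nlinarith

theorem halfWidth_ge {y : ℝ} (h2 : y ≤ 2 / 3) (h0 : 0 ≤ y) : 0.132 ≤ halfWidth y := by
  rcases le_or_gt y (√3 / 3) with h | h
  · rw [halfWidth_of_le h]; nlinarith
  · rw [halfWidth_of_ge h]; exact rollWidth_ge h.le h2

theorem one_third_le_halfWidth {y : ℝ} (h : y ≤ √3 / 3) (h0 : 0 ≤ y) : 1 / 3 ≤ halfWidth y := by
  have hr := sqrt_three_sq
  rw [halfWidth_of_le h]; nlinarith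

/-- If the middle vertex is low, a triangle protruding from the region has a large perimeter. -/
theorem not_perim_of_low {s h D y C S σ : ℝ} (hs : 0 ≤ s) (hC0 : 0 < C) (hCS : C ^ 2 + S ^ 2 = 1)
    (hS0 : 0 ≤ S) (hS2 : 0.15 < S) (hhC : h = C * √3 / 3 + S / 3) (hσC : σ = C * √3 / 3 - S / 3)
    (hcase : s ≤ √3 / 3 - 7 / 3 * S - S ^ 2)
    (hcon : (1 - s ^ 2) / 2 + (2 / 3 * C + σ ^ 2 / 2 - 1 / 2) < D)
    (hy : 2 * h - s ≤ √3 * y) : ¬ perim s h D y ≤ 2 := by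
  intro hP
  obtain ⟨hr1, hr2⟩ := sqrt_three_bounds
  set r := √3
  -- For larger `S` the threshold in `hcase` would be negative, against `0 ≤ s`.
  have hS3 : S ≤ 0.23 := by
    by_contra hlt
    push Not at hlt
    have : (0.23 : ℝ) ^ 2 ≤ S ^ 2 := pow_le_pow_left₀ (by norm_num) hlt.le 2
    linarith
  have hSS : S ^ 2 ≤ 0.23 ^ 2 := pow_le_pow_left₀ hS0 hS3 2
  have hC1 : 0.973 ≤ C := by
    by_contra hlt
    push Not at hlt
    have : C ^ 2 ≤ 0.973 ^ 2 := pow_le_pow_left₀ hC0.le hlt.le 2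
    linarith
  have hs1 : s ≤ 0.205 := by
    have : (0.15 : ℝ) ^ 2 ≤ S ^ 2 := pow_le_pow_left₀ (by norm_num) hS2.le 2
    linarith
  have hCr : 0.973 * 1.732 ≤ C * r := mul_le_mul hC1 hr1.le (by norm_num) hC0.le
  have hh3 : 0.61 ≤ h := by linarith
  have hσ4 : 0.485 ≤ σ := by linarith
  have hD1 : 0.744 ≤ D := by
    have h1 : (0.485 : ℝ) ^ 2 ≤ σ ^ 2 := pow_le_pow_left₀ (by norm_num) hσ4 2
    have h2 : s ^ 2 ≤ 0.205 ^ 2 := pow_le_pow_left₀ hs hs1 2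
    linarith
  -- The three sides are bounded below by projections onto fixed vectors of norm at most 1.
  have e1 := linear_le_sqrt (α := 0.88) (β := 0.47) (by norm_num) D (h - s)
  have e2 := le_trans (le_abs_self _) (abs_right_le_sqrt (D - y) h)
  have e3 := linear_le_sqrt (α := 0.91) (β := 0.41) (by norm_num) y s
  have hy1 : 0.577 * (2 * h - s) ≤ y := by
    by_contra hlt
    push Not at hlt
    have h1 : r * y ≤ r * (0.577 * (2 * h - s)) := mul_le_mul_of_nonneg_left hlt.le (by linarith)
    have h2 : r * (0.577 * (2 * h - s)) ≤ 1.7321 * (0.577 * (2 * h - s)) :=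
      mul_le_mul_of_nonneg_right hr2.le (by linarith)
    linarith
  unfold perim at hP
  linarith

/-- If all three widths are at least the height, the triangle fits as well as the equilateral
triangles do. -/
theorem extent_le_of_widths {s h D y : ℝ} (hs : 0 ≤ s) (hsh : s ≤ h) (hh1 : √3 / 3 < h)
    (hh2 : h ≤ 2 / 3) (hD : h + s ≤ √3 * D) (hy : 2 * h - s ≤ √3 * y)
    (hP : perim s h D y ≤ 2) : D ≤ halfWidth s + halfWidth h := by
  obtain ⟨hr1, hr2⟩ := sqrt_three_bounds
  have hr := sqrt_three_sq
  have hside := equilateral_side_le hs hsh (by linarith) hD hy hP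
  have hsσ := le_leftHeight hside
  have hh0 : 0 ≤ h := by linarith
  have hσa := leftHeight_le hh1.le hh2
  have hσh := leftHeight_le_self hh1.le
  have hspec := leftHeight_spec hh2 hh0
  have hσ3 := one_third_le_leftHeight hh2 hh0
  rw [halfWidth_of_le (hsσ.trans hσa), halfWidth_of_ge hh1]
  have hsum := sum_leftHeight_le hh2 hh0
  have hroll := rollWidth_eq_sub hh2 hh0
  have hW : rollWidth h = -1 / 2 + (h + leftHeight h) * √3 / 3 + leftHeight h ^ 2 / 2 := rfl
  set σ := leftHeight h
  set r := √3
  -- `C` and `S` are the cosine and sine of the inclination of the side joining the middle and top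
  -- vertices of the extremal equilateral triangle; `h` and `σ` are then `2 / 3` times the sines of
  -- 60° plus and minus that angle.
  obtain ⟨C, hC⟩ : ∃ C, C = r * (h + σ) / 2 := ⟨_, rfl⟩
  obtain ⟨S, hS⟩ : ∃ S, S = 3 * (h - σ) / 2 := ⟨_, rfl⟩
  have hhC : h = C * r / 3 + S / 3 := by
    rw [hC, hS]; linear_combination (-(h + σ) / 6) * hr
  have hσC : σ = C * r / 3 - S / 3 := by
    rw [hC, hS]; linear_combination (-(h + σ) / 6) * hr
  have hCS : C ^ 2 + S ^ 2 = 1 := by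
    rw [hC, hS]; linear_combination (h + σ) ^ 2 / 4 * hr + 3 * hspec
  have hC0 : 0 < C := by rw [hC]; apply div_pos (mul_pos _ _) <;> linarith
  have hS0 : 0 ≤ S := by linarith
  have hS1 : S ≤ 1 / 2 := by linarith
  rw [← hC] at hroll hsum
  have hroll2 : rollWidth h = 2 / 3 * C + σ ^ 2 / 2 - 1 / 2 := by rw [hW, hC]; ring
  rcases le_or_gt (r / 3 - 7 / 3 * S - S ^ 2) s with hcase | hcase
  -- The perimeter is bounded below by its linearisation at the extremal triangle, by projecting the
  -- sides onto that triangle's side vectors of length `2 / 3`; `hy` then eliminates `y`.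
  · have ht : r * σ * D + (3 * h - 2 * s) * (h - σ) + h ^ 2 + s * σ ≤ 4 / 3 := by
      have e1 := linear_le_mul_sqrt (α := (h + σ) * r / 3) (β := h - σ) (M := 2 / 3) (by norm_num)
        (le_of_eq (by linear_combination (h + σ) ^ 2 / 9 * hr + 4 / 3 * hspec)) D (h - s)
      have e2 := linear_le_mul_sqrt (α := (2 * σ - h) * r / 3) (β := h) (M := 2 / 3) (by norm_num)
        (le_of_eq (by linear_combination (2 * σ - h) ^ 2 / 9 * hr + 4 / 3 * hspec)) (D - y) h
      have e3 := linear_le_mul_sqrt (α := (2 * h - σ) * r / 3) (β := σ) (M := 2 / 3) (by norm_num)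
        (le_of_eq (by linear_combination (2 * h - σ) ^ 2 / 9 * hr + 4 / 3 * hspec)) y s
      have e4 := mul_le_mul_of_nonneg_left hy (sub_nonneg.2 hσh)
      unfold perim at hP
      linarith
    have h1 : (C - S * r / 3) * (D - 2 / 3 * C) ≤
        (C * r / 3 - S / 3 - s) * (C * r / 3 - 5 / 3 * S) := by
      have h2 : C - S * r / 3 = r * σ := by rw [hσC]; linear_combination (-C / 3) * hr
      have h3 : C * r / 3 - 5 / 3 * S = 3 * σ - 2 * h := by rw [hσC, hhC]; ring
      have h4 : r * σ * (2 / 3 * C) = σ * (h + σ) := by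
        rw [hC]; linear_combination σ * (h + σ) / 3 * hr
      rw [h2, h3, ← hσC, mul_sub, h4]
      linarith only [ht, hspec]
    have h5 := tangent_decides hC0 hCS hS0 hS1 (hσC ▸ hsσ) hcase h1
    rw [← hσC] at h5
    linarith
  · rcases le_or_gt S 0.15 with hS2 | hS2
    · have := ellipse_decides hC0.le hCS hS0 hS2 hhC hs hcase.le (ellipse_bound hP)
      linarith
    · by_contra hcon
      push Not at hcon
      exact not_perim_of_low hs hC0 hCS hS0 hS2 hhC hσC hcase.le (by linarith) hy hP

/-- If the third vertex is far to the left, the widths force a long horizontal extent. -/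
theorem not_ellipse_of_extent {s h D y : ℝ} (hsh : s ≤ h) (hh1 : √3 / 3 < h)
    (hh2 : h ≤ 2 / 3) (hD : 3 * h - s ≤ √3 * D) : ¬ perim s h D y ≤ 2 := by
  intro hP
  have hr0 := sqrt_three_bounds.1
  have hr := sqrt_three_sq
  have he := ellipse_bound hP
  have h1 : 1 / 3 < h ^ 2 := by nlinarith
  have h2 : h ^ 2 ≤ 4 / 9 := by nlinarith
  have h3 : (3 * h - s) ^ 2 ≤ 3 * D ^ 2 := by
    have := pow_le_pow_left₀ (by linarith) hD 2
    rwa [mul_pow, hr] at this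
  have h4 : 4 * h ^ 2 - 2 * h * s - 1 + s ^ 2 * (4 / 3 - h ^ 2) ≤ 0 := by linarith
  -- Multiplying by the leading coefficient allows completing the square in `s`; the remainder is a
  -- positive multiple of `h6`.
  have h5 := mul_nonpos_of_nonneg_of_nonpos (show 0 ≤ 4 / 3 - h ^ 2 by linarith) h4
  have h6 : 0 < (3 * h ^ 2 - 1) * (1 - h ^ 2) := mul_pos (by linarith) (by linarith)
  nlinarith [sq_nonneg (s * (4 / 3 - h ^ 2) - h)]

/-- If the third vertex is far to the right, the perimeter is too large. -/
theorem not_perim_of_right {s h D y : ℝ} (hs : 0 ≤ s) (hh1 : √3 / 3 < h)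
    (hh2 : h ≤ 2 / 3) (hcon : halfWidth s + halfWidth h < D) (hD : √3 * D < h + s)
    (hsh : s ≤ h) (hy1 : h + √3 * D ≤ √3 * y) (hy2 : 2 * h + s ≤ √3 * y) :
    ¬ perim s h D y ≤ 2 := by
  intro hP
  obtain ⟨hr1, hr2⟩ := sqrt_three_bounds
  have hr := sqrt_three_sq
  have hwh := halfWidth_ge hh2 (by linarith)
  have hws := halfWidth_ge (hsh.trans hh2) hs
  have e1 := le_trans (le_abs_self _) (abs_left_le_sqrt D (h - s))
  have e2 := linear_le_sqrt (α := -1 / 2) (β := √3 / 2) (by nlinarith) (D - y) h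
  have e3 := linear_le_sqrt (α := 12 / 13) (β := 5 / 13) (by norm_num) y s
  have hy3 : 0.577 * h ≤ y - D := by nlinarith only [hy1, hr1, hr2, hh1]
  have hy4 : 0.577 * (2 * h + s) ≤ y := by nlinarith only [hy2, hr1, hr2, hh1, hs]
  have h5 : 0.866 * h ≤ √3 / 2 * h := by nlinarith only [hr1, hh1]
  unfold perim at hP
  rcases le_or_gt s (√3 / 3) with h | h
  · have := one_third_le_halfWidth h hs
    have : 0.32 ≤ s := by
      have h3 := halfWidth_of_le h
      by_contra hlt
      push Not at hlt
      have h4 : s ^ 2 ≤ 0.32 ^ 2 := pow_le_pow_left₀ hs hlt.le 2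
      have h6 : 0.58 ≤ D := by linarith
      nlinarith only [h6, hr1, hD, hlt, hh2]
    linarith
  · linarith

/-- The horizontal distance between the middle and the top vertex. -/
theorem extent_le {s h D y : ℝ} (hs : 0 ≤ s) (hsh : s ≤ h) (hh1 : √3 / 3 < h)
    (hh2 : h ≤ 2 / 3)
    (hW1 : 2 * h ≤ max |s - √3 * y| (max |h + √3 * D - √3 * y| |h + √3 * D - s|))
    (hW2 : 2 * h ≤ max |-s - √3 * y| (max |√3 * D - h - √3 * y| |√3 * D - h + s|))
    (hP : perim s h D y ≤ 2) : D ≤ halfWidth s + halfWidth h := by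
  by_contra hcon
  push Not at hcon
  obtain ⟨hr1, hr2⟩ := sqrt_three_bounds
  have hr := sqrt_three_sq
  have hwh := halfWidth_ge hh2 (by linarith)
  have hws := halfWidth_ge (hsh.trans hh2) hs
  have hD0 : h - s < √3 * D := by
    rcases le_or_gt s (√3 / 3) with h' | h'
    · have := one_third_le_halfWidth h' hs
      nlinarith
    · nlinarith
  have hDpos : 0 < √3 * D := by nlinarith
  -- The order of the values `-s`, `√3 * D - h`, `√3 * y` tells which two vertices realise the
  -- second oblique width.
  rcases lt_or_ge (√3 * y) (√3 * D - h) with hA | hB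
  · rcases le_or_gt (-s) (√3 * y) with h1 | h1
    · refine not_ellipse_of_extent hsh hh1 hh2 ?_ hP
      rcases le_max_iff.1 hW2 with h2 | h2
      · rw [abs_of_nonpos (by linarith)] at h2; linarith
      · rcases le_max_iff.1 h2 with h2 | h2
        · rw [abs_of_nonneg (by linarith)] at h2; linarith
        · rw [abs_of_nonneg (by linarith)] at h2; linarith
    · have h3 : 3 * h ≤ √3 * (D - y) := by
        rcases le_max_iff.1 hW2 with h2 | h2
        · rw [abs_of_nonneg (by linarith)] at h2; linarith
        · rcases le_max_iff.1 h2 with h2 | h2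
          · rw [abs_of_nonneg (by linarith)] at h2; linarith
          · rw [abs_of_nonneg (by linarith)] at h2; linarith
      have h4 := sqrt_add_le D (h - s) (-y) s
      rw [show D + -y = D - y by ring, show h - s + s = h by ring, neg_sq] at h4
      unfold perim at hP
      have e2 := linear_le_sqrt (α := √3 / 2) (β := 1 / 2) (by nlinarith) (D - y) h
      linarith
  · have hy : 2 * h - s ≤ √3 * y := by
      rcases le_max_iff.1 hW2 with h2 | h2
      · rw [abs_of_nonpos (by linarith)] at h2; linarith
      · rcases le_max_iff.1 h2 with h2 | h2
        · rw [abs_of_nonpos (by linarith)] at h2; linarith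
        · rw [abs_of_nonneg (by linarith)] at h2; linarith
    rcases le_or_gt (h + s) (√3 * D) with hD | hD
    · exact hcon.not_ge (extent_le_of_widths hs hsh hh1 hh2 hD hy hP)
    · have h5 : h + √3 * D ≤ √3 * y := by
        by_contra hlt
        push Not at hlt
        rcases le_max_iff.1 hW1 with h2 | h2
        · rw [abs_of_nonpos (by linarith)] at h2; linarith
        · rcases le_max_iff.1 h2 with h2 | h2
          · rw [abs_of_nonneg (by linarith)] at h2; linarith
          · rw [abs_of_nonneg (by linarith)] at h2; linarith
      have h6 : 2 * h + s ≤ √3 * y := by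
        rcases le_max_iff.1 hW1 with h2 | h2
        · rw [abs_of_nonpos (by linarith)] at h2; linarith
        · rcases le_max_iff.1 h2 with h2 | h2
          · rw [abs_of_nonpos (by linarith)] at h2; linarith
          · rw [abs_of_nonneg (by linarith)] at h2; linarith
      exact not_perim_of_right hs hh1 hh2 hcon hD hsh h5 h6 hP

/-- The horizontal distance between the bottom vertex and another vertex. -/
theorem extent_le_of_bottom {q u x t h : ℝ} (hq0 : 0 ≤ q) (hqh : q ≤ h) (hh2 : h ≤ 2 / 3)
    (hW : 2 * h ≤ max |√3 * u - q| (max |√3 * x - t| |√3 * x - t - (√3 * u - q)|))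
    (hP : √(u ^ 2 + q ^ 2) + √((x - u) ^ 2 + (t - q) ^ 2) + √(x ^ 2 + t ^ 2) ≤ 2) :
    u ≤ 1 / 2 + halfWidth q := by
  by_contra hcon
  push Not at hcon
  obtain ⟨hr1, hr2⟩ := sqrt_three_bounds
  have hr := sqrt_three_sq
  have hone : √(u ^ 2 + q ^ 2) ≤ 1 := by
    -- No side is longer than half the perimeter.
    have h4 := sqrt_add_le (x - u) (t - q) (-x) (-t)
    rw [show (x - u + -x) ^ 2 = u ^ 2 by ring, show (t - q + -t) ^ 2 = q ^ 2 by ring, neg_sq,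
      neg_sq] at h4
    linarith
  rcases le_or_gt q (√3 / 3) with h | hqa
  · rw [halfWidth_of_le h] at hcon
    have : u ^ 2 + q ^ 2 ≤ 1 := by
      have := (Real.sqrt_le_left (by norm_num)).1 hone
      linarith
    nlinarith [sq_nonneg (q ^ 2)]
  · have hw := halfWidth_ge (hqh.trans hh2) hq0
    have e0 := linear_le_sqrt (α := 0.8) (β := 0.6) (by norm_num) u q
    have hk0 : 0 ≤ √3 * u - q := by nlinarith only [hw, hr1, hcon, hqh, hh2]
    have hk1 : √3 * u - q < 2 * h := by
      have : u ≤ 1 := (le_trans (le_abs_self _) (abs_left_le_sqrt u q)).trans hone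
      nlinarith only [this, hr1, hr2, hqa, hqh]
    -- The given side is too short in the oblique direction to realise the width (`hk1`), so the
    -- third vertex must overshoot one of its ends.
    have habs : 4 * q - (√3 * u - q) ≤ |√3 * x - t| + |√3 * x - t - (√3 * u - q)| := by
      rw [abs_of_nonneg hk0] at hW
      have h1 := abs_sub_abs_le_abs_sub (√3 * x - t) (√3 * x - t - (√3 * u - q))
      have h2 := abs_sub_abs_le_abs_sub (√3 * x - t - (√3 * u - q)) (√3 * x - t)
      rw [show √3 * x - t - (√3 * x - t - (√3 * u - q)) = √3 * u - q by ring,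
        abs_of_nonneg hk0] at h1
      rw [show √3 * x - t - (√3 * u - q) - (√3 * x - t) = -(√3 * u - q) by ring, abs_neg,
        abs_of_nonneg hk0] at h2
      rcases le_max_iff.1 hW with h3 | h3
      · linarith
      · rcases le_max_iff.1 h3 with h3 | h3 <;> linarith
    -- The vectors `(√3, -1)` and `(1, √3)` are orthogonal of norm 2, so weights `±0.4` and `0.3`
    -- give a unit vector.
    have key (ε : ℝ) (hε : ε ^ 2 = 1) (v w : ℝ) :
        0.4 * (ε * (√3 * v - w)) + 0.3 * (v + √3 * w) ≤ √(v ^ 2 + w ^ 2) := by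
      have := linear_le_sqrt (α := 0.4 * ε * √3 + 0.3) (β := -0.4 * ε + 0.3 * √3)
        (by nlinarith only [hε, hr]) v w
      linarith
    have key' (v w : ℝ) : 0.4 * |√3 * v - w| + 0.3 * (v + √3 * w) ≤ √(v ^ 2 + w ^ 2) := by
      rcases abs_cases (√3 * v - w) with ⟨h1, -⟩ | ⟨h1, -⟩ <;> rw [h1]
      · simpa using key 1 (by norm_num) v w
      · simpa using key (-1) (by norm_num) v w
    have e1 := key' x t
    have e2 := key' (u - x) (q - t)
    rw [show √3 * (u - x) - (q - t) = -(√3 * x - t - (√3 * u - q)) by ring, abs_neg,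
      show (u - x) ^ 2 + (q - t) ^ 2 = (x - u) ^ 2 + (t - q) ^ 2 by ring] at e2
    have h3 : √3 * u * 0.4 ≤ 1.7321 * u * 0.4 := by nlinarith only [hr2, hcon, hw]
    have h4 : 1.732 * q ≤ √3 * q := by nlinarith only [hr1, hqa]
    linarith

/-! ### Monotonicity and concavity of the half-width -/

theorem rollWidth_eq {y : ℝ} (h0 : 0 ≤ y) (h2 : y ≤ 2 / 3) :
    rollWidth y = -1 / 3 + √3 / 2 * y - y ^ 2 / 4 +
      √(4 / 3 - 3 * y ^ 2) * (√3 / 6 + y / 4) := by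
  have := Real.sq_sqrt (show 0 ≤ 4 / 3 - 3 * y ^ 2 by nlinarith)
  unfold rollWidth leftHeight
  linear_combination this / 8

theorem continuous_rollWidth : Continuous rollWidth := by
  unfold rollWidth leftHeight
  fun_prop

theorem rollWidth_inv_sqrt_three : rollWidth (√3 / 3) = 1 / 3 := by
  have hr := sqrt_three_sq
  have hr0 := sqrt_three_bounds.1
  have h : leftHeight (√3 / 3) = √3 / 3 := by
    unfold leftHeight
    rw [show (4 : ℝ) / 3 - 3 * (√3 / 3) ^ 2 = (√3 / 3) ^ 2 by linear_combination -4 / 9 * hr,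
      Real.sqrt_sq (by linarith)]
    ring
  unfold rollWidth
  rw [h]
  linear_combination (5 / 18 : ℝ) * hr

/-- The derivative of `rollWidth` on `(0, 2 / 3)`. -/
noncomputable def rollWidthDeriv (y : ℝ) : ℝ :=
  √3 / 2 - y / 2 + √(4 / 3 - 3 * y ^ 2) / 4 - 3 * y / √(4 / 3 - 3 * y ^ 2) * (√3 / 6 + y / 4)

theorem four_thirds_sub_pos {y : ℝ} (h0 : 0 ≤ y) (h2 : y < 2 / 3) : 0 < 4 / 3 - 3 * y ^ 2 := by
  nlinarith

theorem hasDerivAt_sqrt_four_thirds {y : ℝ} (h0 : 0 ≤ y) (h2 : y < 2 / 3) :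
    HasDerivAt (fun y : ℝ => √(4 / 3 - 3 * y ^ 2)) (-(3 * y / √(4 / 3 - 3 * y ^ 2))) y := by
  have h1 : HasDerivAt (fun y : ℝ => 4 / 3 - 3 * y ^ 2) (-(6 * y)) y := by
    refine (((hasDerivAt_pow 2 y).const_mul 3).const_sub (4 / 3)).congr_deriv ?_
    norm_num
    ring
  refine (h1.sqrt (four_thirds_sub_pos h0 h2).ne').congr_deriv ?_
  have := (Real.sqrt_pos.2 (four_thirds_sub_pos h0 h2)).ne'
  field_simp
  ring

theorem hasDerivAt_rollWidth {y : ℝ} (h0 : 0 < y) (h2 : y < 2 / 3) :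
    HasDerivAt rollWidth (rollWidthDeriv y) y := by
  have h1 := hasDerivAt_sqrt_four_thirds h0.le h2
  have h3 : HasDerivAt (fun y : ℝ => -1 / 3 + √3 / 2 * y - y ^ 2 / 4 +
      √(4 / 3 - 3 * y ^ 2) * (√3 / 6 + y / 4)) (rollWidthDeriv y) y := by
    have := ((((hasDerivAt_id y).const_mul (√3 / 2)).const_add (-1 / 3)).sub
      ((hasDerivAt_pow 2 y).div_const 4)).add
      (h1.mul (((hasDerivAt_id y).div_const 4).const_add (√3 / 6)))
    refine this.congr_deriv ?_
    unfold rollWidthDeriv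
    simp only [id, Nat.cast_ofNat]
    ring
  refine h3.congr_of_eventuallyEq ?_
  filter_upwards [Ioo_mem_nhds h0 h2] with x hx
  exact rollWidth_eq hx.1.le hx.2.le

theorem rollWidthDeriv_anti {x y : ℝ} (h0 : 0 ≤ x) (hxy : x ≤ y) (h2 : y < 2 / 3) :
    rollWidthDeriv y ≤ rollWidthDeriv x := by
  have h1 : √(4 / 3 - 3 * y ^ 2) ≤ √(4 / 3 - 3 * x ^ 2) := Real.sqrt_le_sqrt (by nlinarith)
  have h3 := Real.sqrt_pos.2 (four_thirds_sub_pos (h0.trans hxy) h2)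
  unfold rollWidthDeriv
  have h4 : 3 * x / √(4 / 3 - 3 * x ^ 2) * (√3 / 6 + x / 4) ≤
      3 * y / √(4 / 3 - 3 * y ^ 2) * (√3 / 6 + y / 4) := by
    have := h0.trans hxy
    gcongr
  linarith

/-- The parabola `(1 - y ^ 2) / 2` has the same slope here, so the boundary has no corner at the
junction. -/
theorem rollWidthDeriv_inv_sqrt_three : rollWidthDeriv (√3 / 3) = -(√3 / 3) := by
  have hr := sqrt_three_sq
  have hr0 := sqrt_three_bounds.1
  unfold rollWidthDeriv
  rw [show (4 : ℝ) / 3 - 3 * (√3 / 3) ^ 2 = (√3 / 3) ^ 2 by linear_combination -4 / 9 * hr,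
      Real.sqrt_sq (by linarith)]
  field_simp
  ring

theorem inv_sqrt_three_lt : √3 / 3 < 2 / 3 := by linarith [sqrt_three_bounds.2]

theorem hasDerivAt_rollWidth_add {y : ℝ} (h0 : 0 < y) (h2 : y < 2 / 3) :
    HasDerivAt (fun y => rollWidth y + √3 / 3 * y) (rollWidthDeriv y + √3 / 3) y :=
  ((hasDerivAt_rollWidth h0 h2).add ((hasDerivAt_id y).const_mul (√3 / 3))).congr_deriv
    (by rw [mul_one])

/-- Adding `√3 / 3 * y` cancels the slope at the junction. The sum is antitone as well as concave,
hence stays concave after composition with the convex function `max y (√3 / 3)`. -/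
theorem antitoneOn_rollWidth_add :
    AntitoneOn (fun y => rollWidth y + √3 / 3 * y) (Set.Icc (√3 / 3) (2 / 3)) := by
  have hr0 := sqrt_three_bounds.1
  apply antitoneOn_of_deriv_nonpos (convex_Icc _ _)
  · exact (continuous_rollWidth.add (by fun_prop)).continuousOn
  · rw [interior_Icc]
    intro y hy
    exact (hasDerivAt_rollWidth_add (by linarith [hy.1]) hy.2).differentiableAt.differentiableWithinAt
  · rw [interior_Icc]
    intro y hy
    rw [(hasDerivAt_rollWidth_add (by linarith [hy.1]) hy.2).deriv]
    have := rollWidthDeriv_anti (by positivity) hy.1.le hy.2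
    rw [rollWidthDeriv_inv_sqrt_three] at this
    linarith

theorem concaveOn_rollWidth_add :
    ConcaveOn ℝ (Set.Icc (√3 / 3) (2 / 3)) (fun y => rollWidth y + √3 / 3 * y) := by
  have hr0 := sqrt_three_bounds.1
  apply AntitoneOn.concaveOn_of_deriv (convex_Icc _ _)
  · exact (continuous_rollWidth.add (by fun_prop)).continuousOn
  · rw [interior_Icc]
    intro y hy
    exact (hasDerivAt_rollWidth_add (by linarith [hy.1]) hy.2).differentiableAt.differentiableWithinAt
  · rw [interior_Icc]
    intro x hx y hy hxy
    rw [(hasDerivAt_rollWidth_add (by linarith [hy.1]) hy.2).deriv,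
      (hasDerivAt_rollWidth_add (by linarith [hx.1]) hx.2).deriv]
    have := rollWidthDeriv_anti (by linarith [hx.1]) hxy hy.2
    linarith

theorem rollWidth_lt {x y : ℝ} (hx : √3 / 3 ≤ x) (hxy : x < y) (hy : y ≤ 2 / 3) :
    rollWidth y < rollWidth x := by
  have h : rollWidth y + √3 / 3 * y ≤ rollWidth x + √3 / 3 * x :=
    antitoneOn_rollWidth_add ⟨hx, hxy.le.trans hy⟩ ⟨hx.trans hxy.le, hy⟩ hxy.le
  have hr0 := sqrt_three_bounds.1
  have : √3 / 3 * x < √3 / 3 * y := mul_lt_mul_of_pos_left hxy (by positivity)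
  linarith

/-- Below `√3 / 3` the second function is the tangent line common to both pieces, which lies above
the parabola; beyond that height it is `rollWidth`, which lies below it. -/
theorem halfWidth_eq_min {y : ℝ} (hy0 : 0 ≤ y) (hy : y ≤ 2 / 3) :
    halfWidth y = min ((1 - y ^ 2) / 2)
      ((rollWidth (max y (√3 / 3)) + √3 / 3 * max y (√3 / 3)) - √3 / 3 * y) := by
  have hr := sqrt_three_sq
  rcases le_or_gt y (√3 / 3) with h | h
  · rw [halfWidth_of_le h, max_eq_right h, rollWidth_inv_sqrt_three, min_eq_left]
    nlinarith [sq_nonneg (y - √3 / 3)]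
  · rw [halfWidth_of_ge h, max_eq_left h.le, add_sub_cancel_right, min_eq_right]
    exact rollWidth_le hy hy0

theorem concaveOn_halfWidth : ConcaveOn ℝ (Set.Icc 0 (2 / 3)) halfWidth := by
  have hr0 := sqrt_three_bounds.1
  have himage : (fun y : ℝ => max y (√3 / 3)) '' Set.Icc 0 (2 / 3) ⊆ Set.Icc (√3 / 3) (2 / 3) := by
    rintro _ ⟨y, hy, rfl⟩
    exact ⟨le_max_right _ _, max_le hy.2 inv_sqrt_three_lt.le⟩
  have himage' : Convex ℝ ((fun y : ℝ => max y (√3 / 3)) '' Set.Icc 0 (2 / 3)) := by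
    apply Set.OrdConnected.convex
    apply IsPreconnected.ordConnected
    exact isPreconnected_Icc.image _ (by fun_prop)
  have h1 : ConcaveOn ℝ (Set.Icc 0 (2 / 3))
      (fun y => rollWidth (max y (√3 / 3)) + √3 / 3 * max y (√3 / 3)) :=
    ConcaveOn.comp_convexOn (concaveOn_rollWidth_add.subset himage himage')
      ((convexOn_id (convex_Icc _ _)).sup (convexOn_const _ (convex_Icc _ _)))
      (antitoneOn_rollWidth_add.mono himage)
  have h2 : ConcaveOn ℝ (Set.Icc 0 (2 / 3)) (fun y : ℝ => (1 - y ^ 2) / 2) := by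
    refine ⟨convex_Icc _ _, fun x _ y _ a b ha hb hab => ?_⟩
    obtain rfl : b = 1 - a := by linarith
    simp only [smul_eq_mul]
    nlinarith [mul_nonneg (mul_nonneg ha hb) (sq_nonneg (x - y))]
  have h3 : ConvexOn ℝ (Set.Icc 0 (2 / 3)) (fun y : ℝ => √3 / 3 * y) :=
    ⟨convex_Icc _ _, fun x _ y _ a b _ _ _ => by simp only [smul_eq_mul]; apply le_of_eq; ring⟩
  refine (h2.inf (h1.sub h3)).congr fun y hy => ?_
  rw [halfWidth_eq_min hy.1 hy.2]
  rfl

/-! ### The shaved region in terms of the half-width -/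

/-- The region swept by the horizontal segments of half-length `halfWidth`. -/
def slicedRegion : Set ℂ := {z | 0 ≤ z.im ∧ z.im ≤ 2 / 3 ∧ |z.re| ≤ halfWidth z.im}

theorem convex_slicedRegion : Convex ℝ slicedRegion := by
  intro p hp q hq a b ha hb hab
  have h1 := (convex_Icc (0 : ℝ) (2 / 3)) ⟨hp.1, hp.2.1⟩ ⟨hq.1, hq.2.1⟩ ha hb hab
  have h2 := concaveOn_halfWidth.2 ⟨hp.1, hp.2.1⟩ ⟨hq.1, hq.2.1⟩ ha hb hab
  simp only [smul_eq_mul] at h1 h2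
  refine ⟨by simpa using h1.1, by simpa using h1.2, ?_⟩
  have h3 : |(a • p + b • q).re| ≤ a * |p.re| + b * |q.re| := by
    simp only [Complex.add_re, Complex.real_smul, Complex.re_ofReal_mul]
    refine (abs_add_le _ _).trans ?_
    rw [abs_mul, abs_mul, abs_of_nonneg ha, abs_of_nonneg hb]
  have h4 := mul_le_mul_of_nonneg_left hp.2.2 ha
  have h5 := mul_le_mul_of_nonneg_left hq.2.2 hb
  have h6 : (a • p + b • q).im = a * p.im + b * q.im := by simp
  rw [h6]
  linarith

/-- With `s` the height of `rollX t`, the equilateral relation is quadratic in `s`. The bound `-4 /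
9 ≤ t` selects its larger root, and `t ≤ -1 / 3` makes `rollZ t` at least as high as `rollX t`. -/
theorem rollZ_spec {t : ℝ} (ht : t ∈ Set.Icc (-4 / 9 : ℝ) (-1 / 3)) :
    √3 / 3 ≤ (rollZ t).im ∧ (rollZ t).im ≤ 2 / 3 ∧ rollWidth (rollZ t).im = (rollZ t).re := by
  have hr := sqrt_three_sq
  have hr0 := sqrt_three_bounds.1
  have h1 : √(6 * t + 3) = √3 * √(1 + 2 * t) := by
    rw [← Real.sqrt_mul (by norm_num)]; congr 1; ring
  have h2 : √(-6 * t - 5 / 3) = √3 * √(-2 * t - 5 / 9) := by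
    rw [← Real.sqrt_mul (by norm_num)]; congr 1; ring
  have h3 : √(2 * t + 1) = √(1 + 2 * t) := by rw [add_comm]
  rw [rollZ_eq, h1, h2, h3]
  have hs : √(1 + 2 * t) ^ 2 = 1 + 2 * t := Real.sq_sqrt (by linarith [ht.1])
  have hR : √(-2 * t - 5 / 9) ^ 2 = -2 * t - 5 / 9 := Real.sq_sqrt (by linarith [ht.2])
  have hs0 := Real.sqrt_nonneg (1 + 2 * t)
  have hR0 := Real.sqrt_nonneg (-2 * t - 5 / 9)
  have ht1 := ht.1
  have ht2 := ht.2
  set s := √(1 + 2 * t)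
  set R := √(-2 * t - 5 / 9)
  set r := √3
  obtain ⟨y, hy⟩ : ∃ y, y = (r * R + s) / 2 := ⟨_, rfl⟩
  simp only [← hy]
  have hrel : y ^ 2 - y * s + s ^ 2 = 1 / 3 := by
    rw [hy]; linear_combination R ^ 2 / 4 * hr + 3 / 4 * hs + 3 / 4 * hR
  have hrR : (r * R) ^ 2 = 3 * (-2 * t - 5 / 9) := by rw [mul_pow, hr, hR]
  have hrR0 : 0 ≤ r * R := by positivity
  have hsR : s ≤ r * R := by
    refine le_of_abs_le (abs_le_of_sq_le_sq ?_ hrR0)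
    linarith
  have hsR' : r * R ≤ 3 * s := by
    refine le_of_abs_le (abs_le_of_sq_le_sq ?_ (by positivity))
    linarith
  have hy2 : y ≤ 2 / 3 := by nlinarith [sq_nonneg (2 * s - y)]
  have hy1 : r / 3 ≤ y := by nlinarith
  refine ⟨hy1, hy2, ?_⟩
  have hL : leftHeight y = s := by
    unfold leftHeight
    rw [show 4 / 3 - 3 * y ^ 2 = (2 * s - y) ^ 2 by linear_combination -4 * hrel,
      Real.sqrt_sq (by linarith)]
    ring
  unfold rollWidth
  rw [hL, hy]
  linear_combination R / 6 * hr + hs / 2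

/-- The abscissa of `rollZ` is continuous in `t` and takes the values `rollWidth (2 / 3)` and `1 /
3` at the endpoints. -/
theorem exists_rollZ_re {x : ℝ} (h1 : rollWidth (2 / 3) ≤ x) (h2 : x ≤ 1 / 3) :
    ∃ t ∈ Set.Icc (-4 / 9 : ℝ) (-1 / 3), (rollZ t).re = x := by
  have hr := sqrt_three_sq
  have hr0 := sqrt_three_bounds.1
  have hc : Continuous fun t => (√(6 * t + 3) + √(-2 * t - 5 / 9) + 2 * t) / 2 := by fun_prop
  have h3 : (√(6 * (-4 / 9 : ℝ) + 3) + √(-2 * (-4 / 9 : ℝ) - 5 / 9) + 2 * (-4 / 9 : ℝ)) / 2 =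
      rollWidth (2 / 3) := by
    unfold rollWidth leftHeight
    rw [show 6 * (-4 / 9 : ℝ) + 3 = (√3 / 3) ^ 2 by linear_combination -1 / 9 * hr,
      show -2 * (-4 / 9 : ℝ) - 5 / 9 = (√3 / 3) ^ 2 by linear_combination -1 / 9 * hr,
      Real.sqrt_sq (by positivity), show (4 : ℝ) / 3 - 3 * (2 / 3) ^ 2 = 0 by norm_num,
      Real.sqrt_zero]
    ring
  have h4 : (√(6 * (-1 / 3 : ℝ) + 3) + √(-2 * (-1 / 3 : ℝ) - 5 / 9) + 2 * (-1 / 3 : ℝ)) / 2 =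
      1 / 3 := by
    rw [show 6 * (-1 / 3 : ℝ) + 3 = 1 ^ 2 by norm_num,
      show -2 * (-1 / 3 : ℝ) - 5 / 9 = (1 / 3) ^ 2 by norm_num,
      Real.sqrt_sq (by positivity), Real.sqrt_sq (by positivity)]
    norm_num
  obtain ⟨t, ht, htx⟩ := intermediate_value_Icc (show (-4 / 9 : ℝ) ≤ -1 / 3 by norm_num)
    hc.continuousOn ⟨h3.trans_le h1, h2.trans_eq h4.symm⟩
  exact ⟨t, ht, by rw [rollZ_eq]; exact htx⟩

theorem mem_gammaThree_iff {z : ℂ} :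
    z ∈ gammaThree ↔ |z.re| ≤ (1 - z.im ^ 2) / 2 ∧ 0 ≤ z.im ∧ z.im ≤ 2 / 3 := by
  rw [abs_le]
  constructor
  · rintro ⟨⟨h1, h2⟩, h3⟩
    exact ⟨⟨by linarith, by linarith⟩, h3⟩
  · rintro ⟨⟨h1, h2⟩, h3⟩
    exact ⟨⟨by linarith, by linarith⟩, h3⟩

/-- Being above the trajectory means being to the right of it. -/
theorem mem_aboveTrajectory_iff {z : ℂ} (hz : z ∈ gammaThree) :
    z ∈ aboveTrajectory ↔ halfWidth z.im < z.re := by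
  obtain ⟨h1, h2, h3⟩ := mem_gammaThree_iff.1 hz
  have hr := sqrt_three_sq
  have hr0 := sqrt_three_bounds.1
  constructor
  · rintro ⟨t, ht, hre, him⟩
    obtain ⟨h4, h5, h6⟩ := rollZ_spec ht
    rw [halfWidth_of_ge (h4.trans_lt him), hre, ← h6]
    exact rollWidth_lt h4 him h3
  · intro h
    have h7 := (le_abs_self _).trans h1
    have h4 : √3 / 3 < z.im := by
      by_contra hle
      rw [halfWidth_of_le (not_lt.1 hle)] at h
      linarith
    rw [halfWidth_of_ge h4] at h
    have h5 : rollWidth (2 / 3) ≤ rollWidth z.im := by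
      rcases h3.eq_or_lt with h' | h'
      · rw [h']
      · exact (rollWidth_lt h4.le h' le_rfl).le
    obtain ⟨t, ht, hre⟩ := exists_rollZ_re (h5.trans h.le) (by nlinarith)
    refine ⟨t, ht, hre.symm, ?_⟩
    obtain ⟨h8, h9, h10⟩ := rollZ_spec ht
    by_contra hle
    rcases (not_lt.1 hle).eq_or_lt with h' | h'
    · rw [h', h10, hre] at h
      exact lt_irrefl _ h
    · have := rollWidth_lt h4.le h' h9
      rw [h10, hre] at this
      linarith

theorem halfWidth_le {y : ℝ} (h2 : y ≤ 2 / 3) (h0 : 0 ≤ y) : halfWidth y ≤ (1 - y ^ 2) / 2 := by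
  rcases le_or_gt y (√3 / 3) with h | h
  · exact (halfWidth_of_le h).le
  · rw [halfWidth_of_ge h]; exact rollWidth_le h2 h0

theorem gammaT_eq : gammaT = slicedRegion := by
  ext z
  have hmirror (hz : z ∈ gammaThree) : (⟨-z.re, z.im⟩ : ℂ) ∈ gammaThree := by
    rw [mem_gammaThree_iff] at hz ⊢
    simpa using hz
  constructor
  · rintro ⟨hz, hz2⟩
    obtain ⟨-, h2, h3⟩ := mem_gammaThree_iff.1 hz
    rw [Set.mem_union, Set.mem_ofPred_eq, mem_aboveTrajectory_iff hz,
      mem_aboveTrajectory_iff (hmirror hz)] at hz2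
    push Not at hz2
    exact ⟨h2, h3, abs_le'.2 hz2⟩
  · rintro ⟨h2, h3, h1⟩
    have hz : z ∈ gammaThree := mem_gammaThree_iff.2 ⟨h1.trans (halfWidth_le h3 h2), h2, h3⟩
    refine ⟨hz, ?_⟩
    rw [Set.mem_union, Set.mem_ofPred_eq, mem_aboveTrajectory_iff hz,
      mem_aboveTrajectory_iff (hmirror hz)]
    push Not
    exact abs_le'.1 h1

/-! ### The area of the shaved region -/

theorem measurable_halfWidth : Measurable halfWidth :=
  Measurable.ite measurableSet_Iic (by fun_prop) continuous_rollWidth.measurable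

theorem volume_slicedRegion :
    volume slicedRegion = ∫⁻ y in Set.Icc (0 : ℝ) (2 / 3), ENNReal.ofReal (2 * halfWidth y) := by
  set A : Set (ℝ × ℝ) := {p | 0 ≤ p.2 ∧ p.2 ≤ 2 / 3 ∧ |p.1| ≤ halfWidth p.2} with hA
  have hmeas : MeasurableSet A := by
    have h1 : Measurable fun p : ℝ × ℝ => |p.1| := by fun_prop
    have h2 : Measurable fun p : ℝ × ℝ => halfWidth p.2 := measurable_halfWidth.comp measurable_snd
    exact (measurableSet_le measurable_const measurable_snd).inter
      ((measurableSet_le measurable_snd measurable_const).inter (measurableSet_le h1 h2))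
  have hpre : slicedRegion = Complex.measurableEquivRealProd ⁻¹' A := by
    ext z
    simp [hA, slicedRegion, Complex.measurableEquivRealProd_apply]
  rw [hpre, Complex.volume_preserving_equiv_real_prod.measure_preimage_equiv,
    Measure.volume_eq_prod, Measure.prod_apply_symm hmeas, ← lintegral_indicator measurableSet_Icc]
  congr 1
  ext y
  by_cases hy : y ∈ Set.Icc (0 : ℝ) (2 / 3)
  · rw [Set.indicator_of_mem hy]
    have : (fun x => (x, y)) ⁻¹' A = Set.Icc (-halfWidth y) (halfWidth y) := by
      ext x
      simp [hA, hy.1, hy.2, abs_le]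
    rw [this, Real.volume_Icc]
    congr 1
    ring
  · rw [Set.indicator_of_notMem hy]
    have : (fun x => (x, y)) ⁻¹' A = ∅ := by
      ext x
      simp only [hA, Set.mem_preimage, Set.mem_ofPred_eq, Set.mem_empty_iff_false, iff_false]
      exact fun h => hy ⟨h.1, h.2.1⟩
    rw [this, measure_empty]

/-- An antiderivative of `rollWidth`. -/
noncomputable def rollWidthPrimitive (y : ℝ) : ℝ :=
  -y / 3 + √3 / 4 * y ^ 2 - y ^ 3 / 12 + √3 / 12 * (y * √(4 / 3 - 3 * y ^ 2)) +
    Real.arcsin (3 / 2 * y) / 9 - √(4 / 3 - 3 * y ^ 2) ^ 3 / 36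

theorem hasDerivAt_rollWidthPrimitive {y : ℝ} (h0 : 0 < y) (h2 : y < 2 / 3) :
    HasDerivAt rollWidthPrimitive (rollWidth y) y := by
  have hr := sqrt_three_sq
  have hr0 := sqrt_three_bounds.1
  have hρ := hasDerivAt_sqrt_four_thirds h0.le h2
  have hpos := four_thirds_sub_pos h0.le h2
  have harc : HasDerivAt (fun y : ℝ => Real.arcsin (3 / 2 * y))
      (√3 / √(4 / 3 - 3 * y ^ 2)) y := by
    have h1 := (Real.hasDerivAt_arcsin (x := 3 / 2 * y) (by linarith) (by linarith)).comp y
      ((hasDerivAt_id y).const_mul (3 / 2))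
    refine h1.congr_deriv ?_
    have h3 : √(4 / 3 - 3 * y ^ 2) = √3 * 2 / 3 * √(1 - (3 / 2 * y) ^ 2) := by
      rw [show (4 : ℝ) / 3 - 3 * y ^ 2 = (√3 * 2 / 3) ^ 2 * (1 - (3 / 2 * y) ^ 2) by
        linear_combination (-4 / 9 * (1 - (3 / 2 * y) ^ 2)) * hr,
        Real.sqrt_mul (by positivity), Real.sqrt_sq (by positivity)]
    have h4 : 0 < √(1 - (3 / 2 * y) ^ 2) := Real.sqrt_pos.2 (by nlinarith)
    rw [h3]
    field_simp
  have h := ((((((hasDerivAt_id y).neg.div_const 3).add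
    ((hasDerivAt_pow 2 y).const_mul (√3 / 4))).sub ((hasDerivAt_pow 3 y).div_const 12)).add
    (((hasDerivAt_id y).mul hρ).const_mul (√3 / 12))).add (harc.div_const 9)).sub
    ((hρ.pow 3).div_const 36)
  refine h.congr_deriv ?_
  rw [rollWidth_eq h0.le h2.le]
  have hsq := Real.sq_sqrt hpos.le
  have hne := (Real.sqrt_pos.2 hpos).ne'
  simp only [id]
  set ρ := √(4 / 3 - 3 * y ^ 2)
  field_simp
  norm_num
  linear_combination -46656 * √3 * hsq

theorem integral_rollWidth :
    ∫ y in (√3 / 3)..(2 / 3), rollWidth y = -20 / 81 + 10 * √3 / 81 + Real.pi / 54 := by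
  have hr := sqrt_three_sq
  have hr0 := sqrt_three_bounds.1
  rw [intervalIntegral.integral_eq_sub_of_hasDerivAt_of_le inv_sqrt_three_lt.le
    (f := rollWidthPrimitive)]
  · have h1 : Real.arcsin (3 / 2 * (√3 / 3)) = Real.pi / 3 := by
      rw [show 3 / 2 * (√3 / 3) = √3 / 2 by ring, ← Real.sin_pi_div_three]
      apply Real.arcsin_sin <;> linarith [Real.pi_pos]
    have h2 : √(4 / 3 - 3 * (√3 / 3) ^ 2) = √3 / 3 := by
      rw [show (4 : ℝ) / 3 - 3 * (√3 / 3) ^ 2 = (√3 / 3) ^ 2 by linear_combination -4 / 9 * hr,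
        Real.sqrt_sq (by linarith)]
    have h3 : √(4 / 3 - 3 * (2 / 3 : ℝ) ^ 2) = 0 := by norm_num
    unfold rollWidthPrimitive
    rw [h1, h2, h3, show (3 : ℝ) / 2 * (2 / 3) = 1 by norm_num, Real.arcsin_one]
    linear_combination (-√3 / 27 + √3 / 243) * hr
  · unfold rollWidthPrimitive
    fun_prop
  · intro y hy
    exact hasDerivAt_rollWidthPrimitive (by linarith [hy.1]) hy.2
  · exact continuous_rollWidth.intervalIntegrable _ _

theorem volume_slicedRegion_lt : volume slicedRegion < ENNReal.ofReal 0.5634 := by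
  have hr := sqrt_three_sq
  have hr0 := sqrt_three_bounds.1
  have h1 : Set.EqOn halfWidth (fun y => (1 - y ^ 2) / 2) (Set.uIcc 0 (√3 / 3)) := by
    intro y hy
    rw [Set.uIcc_of_le (by positivity)] at hy
    exact halfWidth_of_le hy.2
  have h2 : Set.EqOn halfWidth rollWidth (Set.uIcc (√3 / 3) (2 / 3)) := by
    intro y hy
    rw [Set.uIcc_of_le inv_sqrt_three_lt.le] at hy
    rcases hy.1.eq_or_lt with h | h
    · rw [← h, halfWidth_of_le le_rfl, rollWidth_inv_sqrt_three]
      linear_combination -1 / 18 * hr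
    · exact halfWidth_of_ge h
  have hi1 : IntervalIntegrable halfWidth volume 0 (√3 / 3) :=
    (ContinuousOn.congr (by fun_prop) h1).intervalIntegrable
  have hi2 : IntervalIntegrable halfWidth volume (√3 / 3) (2 / 3) :=
    (continuous_rollWidth.continuousOn.congr h2).intervalIntegrable
  have hint : ∫ y in (0 : ℝ)..(2 / 3), 2 * halfWidth y =
      44 * √3 / 81 - 40 / 81 + Real.pi / 27 := by
    rw [intervalIntegral.integral_const_mul, ← intervalIntegral.integral_add_adjacent_intervals hi1 hi2,
      intervalIntegral.integral_congr h1, intervalIntegral.integral_congr h2, integral_rollWidth]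
    have : ∫ y in (0 : ℝ)..(√3 / 3), (1 - y ^ 2) / 2 = (√3 / 3 - (√3 / 3) ^ 3 / 3) / 2 := by
      rw [intervalIntegral.integral_div, intervalIntegral.integral_sub (by simp) (by simp)]
      norm_num
    rw [this]
    linear_combination -√3 / 81 * hr
  have h0 : (0 : ℝ) ≤ 2 / 3 := by norm_num
  rw [volume_slicedRegion, ← ofReal_integral_eq_lintegral_ofReal, integral_Icc_eq_integral_Ioc,
    ← intervalIntegral.integral_of_le h0, hint]
  · have h3 : √3 < 1.7320509 := by
      rw [Real.sqrt_lt' (by norm_num)]; norm_num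
    rw [ENNReal.ofReal_lt_ofReal_iff (by norm_num)]
    linarith [Real.pi_lt_d4]
  · have := (hi1.trans hi2).const_mul 2
    rwa [intervalIntegrable_iff_integrableOn_Icc_of_le h0] at this
  · refine (ae_restrict_iff' measurableSet_Icc).2 (.of_forall fun y hy => ?_)
    have := halfWidth_ge hy.2 hy.1
    simp only [Pi.zero_apply]
    linarith

/-! ### Placing a triangle -/

theorem halfWidth_zero : halfWidth 0 = 1 / 2 := by
  rw [halfWidth_of_le (by positivity)]
  norm_num

/-- The pairwise bounds for the horizontal extent of a triangle with vertices `(x, s)`, `(y, 0)`,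
`(z, h)` none of whose three widths is smaller than its height. -/
theorem extents_le {x y z s h : ℝ} (hs : 0 ≤ s) (hsh : s ≤ h) (hh2 : h ≤ 2 / 3)
    (hW1 : 2 * h ≤ max |√3 * (x - y) + s| (max |√3 * (y - z) - h| |√3 * (z - x) + (h - s)|))
    (hW2 : 2 * h ≤ max |√3 * (x - y) - s| (max |√3 * (y - z) + h| |√3 * (z - x) - (h - s)|))
    (hP : √((x - y) ^ 2 + s ^ 2) + √((y - z) ^ 2 + h ^ 2) + √((z - x) ^ 2 + (h - s) ^ 2) ≤ 2) :
    z - x ≤ halfWidth s + halfWidth h ∧ x - y ≤ 1 / 2 + halfWidth s ∧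
      z - y ≤ 1 / 2 + halfWidth h := by
  refine ⟨?_, ?_, ?_⟩
  · have hper : perim s h (z - x) (y - x) ≤ 2 := by
      refine le_trans (le_of_eq ?_) hP
      unfold perim
      ring_nf
    rcases le_or_gt h (√3 / 3) with hh1 | hh1
    · rw [halfWidth_of_le hh1, halfWidth_of_le (hsh.trans hh1)]
      -- Below the junction the geometric mean in the ellipse bound is at most the arithmetic mean,
      -- which is the sum of the parabola half-widths.
      have h1 := ellipse_bound hper
      refine le_of_abs_le (abs_le_of_sq_le_sq ?_ (by nlinarith))
      nlinarith [sq_nonneg (s ^ 2 - h ^ 2)]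
    · refine extent_le hs hsh hh1 hh2 ?_ ?_ hper
      · refine hW1.trans (le_of_eq ?_)
        congr 1
        · congr 1; ring
        · congr 1
          · rw [← abs_neg]; congr 1; ring
          · congr 1; ring
      · refine hW2.trans (le_of_eq ?_)
        congr 1
        · congr 1; ring
        · congr 1
          · rw [← abs_neg]; congr 1; ring
          · congr 1; ring
  · refine extent_le_of_bottom (x := z - y) (t := h) hs hsh hh2 (hW2.trans (le_of_eq ?_)) ?_
    · congr 1
      congr 1
      · rw [← abs_neg]; congr 1; ring
      · congr 1; ring
    · refine le_trans (le_of_eq ?_) hP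
      ring_nf
  · refine extent_le_of_bottom (x := x - y) (t := s) (hs.trans hsh) le_rfl hh2
      (hW2.trans (le_of_eq ?_)) ?_
    · rw [max_left_comm]
      congr 1
      · rw [← abs_neg]; congr 1; ring
      · congr 1
        rw [← abs_neg]; congr 1; ring
    · refine le_trans (le_of_eq ?_) hP
      ring_nf

/-- The largest difference of the values of the functional `a * re + b * im` at the vertices of
a triangle. -/
noncomputable def width (a b : ℝ) (p q r : ℂ) : ℝ :=
  max |a * (p.re - q.re) + b * (p.im - q.im)|
    (max |a * (q.re - r.re) + b * (q.im - r.im)| |a * (r.re - p.re) + b * (r.im - p.im)|)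

theorem width_rotate (a b : ℝ) (p q r : ℂ) : width a b q r p = width a b p q r :=
  (max_assoc _ _ _).symm.trans (max_comm _ _)

theorem width_swap (a b : ℝ) (p q r : ℂ) : width a b q p r = width a b p q r := by
  unfold width
  congr 1
  · rw [← abs_neg]; congr 1; ring
  · rw [max_comm]
    congr 1 <;> rw [← abs_neg] <;> congr 1 <;> ring

/-- The triangle has perimeter at most `2`, and of its widths in the three directions its height
is the smallest one and at most `2 / 3`. -/
structure IsLow (p q r : ℂ) : Prop where
  perimeter_le : dist p q + dist q r + dist r p ≤ 2
  height_le : width 0 1 p q r ≤ 2 / 3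
  height_le_left : 2 * width 0 1 p q r ≤ width √3 1 p q r
  height_le_right : 2 * width 0 1 p q r ≤ width √3 (-1) p q r

theorem IsLow.rotate {p q r : ℂ} (h : IsLow p q r) : IsLow q r p := by
  obtain ⟨h1, h2, h3, h4⟩ := h
  exact ⟨by linarith, by rwa [width_rotate], by rwa [width_rotate 0, width_rotate √3],
    by rwa [width_rotate 0, width_rotate √3]⟩

theorem IsLow.swap {p q r : ℂ} (h : IsLow p q r) : IsLow q p r := by
  obtain ⟨h1, h2, h3, h4⟩ := h
  refine ⟨?_, by rwa [width_swap], by rwa [width_swap 0, width_swap √3],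
    by rwa [width_swap 0, width_swap √3]⟩
  rw [dist_comm q p, dist_comm p r, dist_comm r q]
  linarith

/-- The triangle can be moved into the region by a translation. -/
def Fits (p q r : ℂ) : Prop :=
  ∃ c : ℂ, p + c ∈ slicedRegion ∧ q + c ∈ slicedRegion ∧ r + c ∈ slicedRegion

theorem Fits.rotate {p q r : ℂ} : Fits p q r → Fits q r p :=
  fun ⟨c, h1, h2, h3⟩ => ⟨c, h2, h3, h1⟩

theorem Fits.swap {p q r : ℂ} : Fits p q r → Fits q p r :=
  fun ⟨c, h1, h2, h3⟩ => ⟨c, h2, h1, h3⟩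

theorem IsLow.fits_of_sorted {p q r : ℂ} (hl : IsLow p q r) (h1 : q.im ≤ p.im)
    (h2 : p.im ≤ r.im) : Fits p q r := by
  obtain ⟨hP, hh, hW1, hW2⟩ := hl
  have hheight : r.im - q.im ≤ width 0 1 p q r := by
    refine le_trans ?_ (le_max_of_le_right (le_max_left _ _))
    rw [← abs_neg]
    refine le_trans (le_of_eq ?_) (le_abs_self _)
    ring
  have hs : 0 ≤ p.im - q.im := sub_nonneg.2 h1
  have hsh : p.im - q.im ≤ r.im - q.im := by linarith
  have hh2 : r.im - q.im ≤ 2 / 3 := hheight.trans hh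
  have hW1' := (mul_le_mul_of_nonneg_left hheight zero_le_two).trans hW1
  have hW2' := (mul_le_mul_of_nonneg_left hheight zero_le_two).trans hW2
  unfold width at hW1' hW2'
  rw [Complex.dist_eq_re_im, Complex.dist_eq_re_im, Complex.dist_eq_re_im] at hP
  obtain ⟨a1, a2, a3⟩ := extents_le (x := p.re) (y := q.re) (z := r.re) hs hsh hh2
    (hW1'.trans (le_of_eq (by ring_nf))) (hW2'.trans (le_of_eq (by ring_nf)))
    (le_trans (le_of_eq (by ring_nf)) hP)
  -- The mirror image gives the bounds for the opposite signs; reflection exchanges the two oblique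
  -- widths.
  obtain ⟨b1, b2, b3⟩ := extents_le (x := -p.re) (y := -q.re) (z := -r.re) hs hsh hh2
    (by
      refine hW2'.trans (le_of_eq ?_)
      congr 1
      · rw [← abs_neg]; congr 1; ring
      · congr 1 <;> rw [← abs_neg] <;> congr 1 <;> ring)
    (by
      refine hW1'.trans (le_of_eq ?_)
      congr 1
      · rw [← abs_neg]; congr 1; ring
      · congr 1 <;> rw [← abs_neg] <;> congr 1 <;> ring)
    (by
      refine le_trans (le_of_eq ?_) hP
      ring_nf)
  have w1 := halfWidth_ge (hsh.trans hh2) hs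
  have w2 := halfWidth_ge hh2 (hs.trans hsh)
  -- The shift is the largest left end of the three admissible intervals; the pairwise bounds keep
  -- it below every right end.
  obtain ⟨c, hc⟩ : ∃ c, c = max (-halfWidth (p.im - q.im) - p.re)
      (max (-(1 / 2) - q.re) (-halfWidth (r.im - q.im) - r.re)) := ⟨_, rfl⟩
  have c1 : -halfWidth (p.im - q.im) - p.re ≤ c := hc ▸ le_max_left _ _
  have c2 : -(1 / 2) - q.re ≤ c := hc ▸ (le_max_left _ _).trans (le_max_right _ _)
  have c3 : -halfWidth (r.im - q.im) - r.re ≤ c := hc ▸ (le_max_right _ _).trans (le_max_right _ _)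
  have d1 : c ≤ halfWidth (p.im - q.im) - p.re := by
    rw [hc]; refine max_le ?_ (max_le ?_ ?_) <;> linarith
  have d2 : c ≤ 1 / 2 - q.re := by
    rw [hc]; refine max_le ?_ (max_le ?_ ?_) <;> linarith
  have d3 : c ≤ halfWidth (r.im - q.im) - r.re := by
    rw [hc]; refine max_le ?_ (max_le ?_ ?_) <;> linarith
  refine ⟨⟨c, -q.im⟩, ⟨?_, ?_, ?_⟩, ⟨?_, ?_, ?_⟩, ⟨?_, ?_, ?_⟩⟩ <;>
    simp only [Complex.add_im, Complex.add_re, ← sub_eq_add_neg, sub_self, halfWidth_zero,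
      abs_le] <;> first | linarith | (constructor <;> linarith)

theorem IsLow.fits {p q r : ℂ} (h : IsLow p q r) : Fits p q r := by
  rcases le_total p.im q.im with h1 | h1
  · rcases le_total q.im r.im with h2 | h2
    · exact (h.swap.fits_of_sorted h1 h2).swap
    · rcases le_total p.im r.im with h3 | h3
      · exact (h.rotate.rotate.fits_of_sorted h3 h2).rotate
      · exact (h.rotate.rotate.swap.fits_of_sorted h3 h1).swap.rotate
  · rcases le_total q.im r.im with h2 | h2
    · rcases le_total p.im r.im with h3 | h3
      · exact h.fits_of_sorted h1 h3
      · exact (h.rotate.swap.fits_of_sorted h2 h3).swap.rotate.rotate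
    · exact (h.rotate.fits_of_sorted h2 h1).rotate.rotate

/-! ### Choosing the rotation -/

theorem two_mul_max_abs_le {a b c : ℝ} (h : a + b + c = 0) :
    2 * max |a| (max |b| |c|) ≤ |a| + |b| + |c| := by
  have h1 : |a| ≤ |b| + |c| := by
    rw [show a = -(b + c) by linarith, abs_neg]; exact abs_add_le _ _
  have h2 : |b| ≤ |a| + |c| := by
    rw [show b = -(a + c) by linarith, abs_neg]; exact abs_add_le _ _
  have h3 : |c| ≤ |a| + |b| := by
    rw [show c = -(a + b) by linarith, abs_neg]; exact abs_add_le _ _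
  rcases max_cases |a| (max |b| |c|) with h4 | h4 <;> rcases max_cases |b| |c| with h5 | h5 <;>
    linarith

/-- Every choice of signs gives zero or a linear form with coefficients `(0, ±2)` or `(±√3, ±1)`, of
norm 2. -/
theorem abs_sum_directions_le (x y : ℝ) :
    |y| + |√3 * x + y| / 2 + |√3 * x - y| / 2 ≤ 2 * √(x ^ 2 + y ^ 2) := by
  have hr := sqrt_three_sq
  have key (α β : ℝ) (h : α ^ 2 + β ^ 2 ≤ 4) : α * x + β * y ≤ 2 * √(x ^ 2 + y ^ 2) :=
    linear_le_mul_sqrt zero_le_two (by linarith) x y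
  have k1 := key 0 2 (by norm_num)
  have k2 := key 0 (-2) (by norm_num)
  have k3 := key √3 1 (by linarith)
  have k4 := key √3 (-1) (by linarith)
  have k5 := key (-√3) 1 (by linarith [neg_sq √3])
  have k6 := key (-√3) (-1) (by linarith [neg_sq √3])
  rcases abs_cases y with ⟨h1, -⟩ | ⟨h1, -⟩ <;>
    rcases abs_cases (√3 * x + y) with ⟨h2, -⟩ | ⟨h2, -⟩ <;>
    rcases abs_cases (√3 * x - y) with ⟨h3, -⟩ | ⟨h3, -⟩ <;> rw [h1, h2, h3] <;> linarith

/-- A width is at most half the sum of the projected sides. The forms with coefficient `√3` have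
norm 2, hence the division by 2. -/
theorem sum_widths_le (p q r : ℂ) :
    width 0 1 p q r + width √3 1 p q r / 2 + width √3 (-1) p q r / 2 ≤
      dist p q + dist q r + dist r p := by
  rw [Complex.dist_eq_re_im, Complex.dist_eq_re_im, Complex.dist_eq_re_im]
  have w (a b : ℝ) := two_mul_max_abs_le (a := a * (p.re - q.re) + b * (p.im - q.im))
    (b := a * (q.re - r.re) + b * (q.im - r.im)) (c := a * (r.re - p.re) + b * (r.im - p.im))
    (by ring)
  have w1 := w 0 1
  have w2 := w √3 1
  have w3 := w √3 (-1)
  have e1 := abs_sum_directions_le (p.re - q.re) (p.im - q.im)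
  have e2 := abs_sum_directions_le (q.re - r.re) (q.im - r.im)
  have e3 := abs_sum_directions_le (r.re - p.re) (r.im - p.im)
  unfold width
  simp only [zero_mul, zero_add, one_mul, neg_one_mul, ← sub_eq_add_neg] at w1 w2 w3 ⊢
  linarith

/-- The rotation by a third of a full turn. -/
noncomputable def thirdTurn : ℂ := ⟨-1 / 2, √3 / 2⟩

theorem thirdTurn_eq_exp : thirdTurn = Complex.exp (2 * (Real.pi : ℂ) * Complex.I / 3) := by
  rw [show (2 * (Real.pi : ℂ) * Complex.I / 3) = ((Real.pi - Real.pi / 3 : ℝ) : ℂ) * Complex.I by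
    push_cast; ring]
  apply Complex.ext
  · rw [Complex.exp_ofReal_mul_I_re, Real.cos_pi_sub, Real.cos_pi_div_three, thirdTurn]
    ring
  · rw [Complex.exp_ofReal_mul_I_im, Real.sin_pi_sub, Real.sin_pi_div_three, thirdTurn]

theorem thirdTurn_pow_three : thirdTurn ^ 3 = 1 := by
  rw [thirdTurn_eq_exp, ← Complex.exp_nat_mul, ← Complex.exp_two_pi_mul_I]
  congr 1
  push_cast
  ring

theorem thirdTurn_pow_eq_exp (n : ℕ) : thirdTurn ^ n =
    Complex.exp (2 * ((n : ℤ) : ℂ) * (Real.pi : ℂ) * Complex.I / ((3 : ℕ) : ℂ)) := by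
  rw [thirdTurn_eq_exp, ← Complex.exp_nat_mul]
  congr 1
  push_cast
  ring

theorem norm_thirdTurn_pow (n : ℕ) : ‖thirdTurn ^ n‖ = 1 := by
  have h : ‖thirdTurn‖ ^ 3 = 1 := by rw [← norm_pow, thirdTurn_pow_three, norm_one]
  rw [norm_pow, (pow_eq_one_iff_of_nonneg (norm_nonneg _) three_ne_zero).1 h, one_pow]

theorem width_thirdTurn (p q r : ℂ) :
    2 * width 0 1 (thirdTurn * p) (thirdTurn * q) (thirdTurn * r) = width √3 (-1) p q r := by
  have key (x y : ℂ) : 2 * |0 * ((thirdTurn * x).re - (thirdTurn * y).re) +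
      1 * ((thirdTurn * x).im - (thirdTurn * y).im)| =
      |√3 * (x.re - y.re) + -1 * (x.im - y.im)| := by
    rw [← abs_two, ← abs_mul]
    congr 1
    simp only [thirdTurn, Complex.mul_re, Complex.mul_im]
    norm_num
    ring
  unfold width
  rw [mul_max_of_nonneg _ _ zero_le_two, mul_max_of_nonneg _ _ zero_le_two, key, key, key]

theorem width_thirdTurn_sq (p q r : ℂ) :
    2 * width 0 1 (thirdTurn ^ 2 * p) (thirdTurn ^ 2 * q) (thirdTurn ^ 2 * r) =
      width √3 1 p q r := by
  have key (x y : ℂ) : 2 * |0 * ((thirdTurn ^ 2 * x).re - (thirdTurn ^ 2 * y).re) +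
      1 * ((thirdTurn ^ 2 * x).im - (thirdTurn ^ 2 * y).im)| =
      |√3 * (x.re - y.re) + 1 * (x.im - y.im)| := by
    rw [← abs_two, ← abs_mul, ← abs_neg]
    congr 1
    simp only [thirdTurn, sq, Complex.mul_re, Complex.mul_im]
    norm_num
    linear_combination (x.im - y.im) / 2 * sqrt_three_sq
  unfold width
  rw [mul_max_of_nonneg _ _ zero_le_two, mul_max_of_nonneg _ _ zero_le_two, key, key, key]

/-- Some rotation of a triangle of perimeter at most `2` brings it into its lowest position. -/
theorem exists_isLow {p q r : ℂ} (hP : dist p q + dist q r + dist r p ≤ 2) :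
    ∃ n : ℕ, IsLow (thirdTurn ^ n * p) (thirdTurn ^ n * q) (thirdTurn ^ n * r) := by
  set f : ℕ → ℝ := fun n =>
    width 0 1 (thirdTurn ^ n * p) (thirdTurn ^ n * q) (thirdTurn ^ n * r) with hf
  obtain ⟨n, -, hn⟩ := Finset.exists_min_image (Finset.range 3) f ⟨0, by simp⟩
  -- Powers of `thirdTurn` have period 3, so a minimum over three rotations is a minimum over all.
  have hmin (m : ℕ) : f n ≤ f m := by
    have h := hn (m % 3) (Finset.mem_range.2 (Nat.mod_lt _ (by norm_num)))
    simp only [hf] at h ⊢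
    rwa [← pow_eq_pow_mod m thirdTurn_pow_three] at h
  have hdist (a b : ℂ) : dist (thirdTurn ^ n * a) (thirdTurn ^ n * b) = dist a b := by
    rw [dist_eq_norm, dist_eq_norm, ← mul_sub, norm_mul, norm_thirdTurn_pow, one_mul]
  have h1 := width_thirdTurn (thirdTurn ^ n * p) (thirdTurn ^ n * q) (thirdTurn ^ n * r)
  have h2 := width_thirdTurn_sq (thirdTurn ^ n * p) (thirdTurn ^ n * q) (thirdTurn ^ n * r)
  simp only [← mul_assoc, ← pow_succ', ← pow_add] at h1 h2
  have m1 := hmin (n + 1)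
  have m2 := hmin (2 + n)
  have hsum := sum_widths_le (thirdTurn ^ n * p) (thirdTurn ^ n * q) (thirdTurn ^ n * r)
  simp only [hf] at m1 m2
  refine ⟨n, ?_, ?_, ?_, ?_⟩
  · rwa [hdist, hdist, hdist]
  · rw [hdist, hdist, hdist] at hsum
    linarith
  · linarith
  · linarith

theorem isCovering_slicedRegion :
    IsCovering (rotTransGroup 3) (trianglesOfPerimeter 2) slicedRegion := by
  rintro T ⟨p, q, r, hP, rfl⟩
  obtain ⟨n, hn⟩ := exists_isLow hP.le
  obtain ⟨c, h1, h2, h3⟩ := hn.fits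
  have hne : thirdTurn ^ n ≠ 0 := by
    intro h
    have := norm_thirdTurn_pow n
    rw [h, norm_zero] at this
    norm_num at this
  set g : Equiv.Perm ℂ := (Equiv.mulLeft₀ _ hne).trans (Equiv.addRight c) with hg
  have hgz (z : ℂ) : g z = thirdTurn ^ n * z + c := rfl
  refine ⟨g, ⟨n, c, fun z => by rw [hgz, thirdTurn_pow_eq_exp]⟩, ?_⟩
  rw [Set.image_subset_iff]
  refine convexHull_min ?_ ?_
  · rintro z (rfl | rfl | rfl)
    · exact h1
    · exact h2
    · exact h3
  -- The preimage of the convex region under the affine map `g` is convex; the translation part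
  -- needs `a + b = 1`.
  · intro x hx y hy a b ha hb hab
    have h := convex_slicedRegion hx hy ha hb hab
    rw [Set.mem_preimage, hgz]
    rw [hgz, hgz] at h
    convert h using 1
    have hab' : (a : ℂ) + b = 1 := by exact_mod_cast hab
    simp only [Complex.real_smul]
    linear_combination (-c) * hab'

end TriangleCover

theorem mainTheorem7 :
    Convex ℝ TriangleCover.gammaT ∧
      volume TriangleCover.gammaT < ENNReal.ofReal 0.5634 ∧
      TriangleCover.IsCovering (TriangleCover.rotTransGroup 3)
        (TriangleCover.trianglesOfPerimeter 2) TriangleCover.gammaT := by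
  rw [TriangleCover.gammaT_eq]
  exact ⟨TriangleCover.convex_slicedRegion, TriangleCover.volume_slicedRegion_lt,
    TriangleCover.isCovering_slicedRegion⟩
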